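/- All algebras are over a field $\mathbf K$ of characteristic $0$. A (right) Zinbiel algebra is an algebra $(A,\circ)$ with $a\circ(b\circ c)=(a\circ b+b\circ a)\circ c$, and $A^{(-)}$ denotes the space $A$ with the product $[a,b]=a\circ b-b\circ a$. A Tortkara algebra is an anticommutative algebra with $(ab)(cb)=J(a,b,c)\,b$, where $J(a,b,c)=(ab)c+(bc)a+(ca)b$. A Tortkara algebra is special if it is isomorphic to a subalgebra of $A^{(-)}$ for some Zinbiel algebra $A$. Let $Zin(X)$ be the free Zinbiel algebra on $X$, write $a_1a_2\cdots a_n=(\cdots(a_1\circ a_2)\circ\cdots)\circ a_n$, and let the free special Tortkara algebra $ST(X)$ be the subalgebra of $Zin(X)^{(-)}$ generated by $X$. Theorem (Cohn-type theorem). (1) Every homomorphic image of the free special Tortkara algebra $ST(\{x,y\})$ on two generators is special. (2) This fails for three generators: let $\alpha$ be the ideal of $ST(\{x,y,z\})$ generated by the skew-right-commutative elements $$\overline{yyz}=yyz-yzy,\qquad \overline{yxz}=yxz-yzx,\qquad \overline{yxy}=yxy-yyx .$$ Then $ST(\{x,y,z\})/\alpha$ is a Tortkara algebra that is not special. -/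

import Mathlib

/-! Zinbiel algebras, Tortkara algebras, speciality, and the free special Tortkara algebra.

A (not necessarily associative, not necessarily unital) algebra over a field `K` is a type `A` with
`[NonUnitalNonAssocRing A] [Module K A] [IsScalarTower K A A] [SMulCommClass K A A]`,
and homomorphisms of such algebras are `A →ₙₐ[K] B`. -/

universe w u v

/-- Right Zinbiel identity `a ∘ (b ∘ c) = (a ∘ b + b ∘ a) ∘ c`. -/
def IsZinbiel (A : Type*) [NonUnitalNonAssocRing A] : Prop :=
  ∀ a b c : A, a * (b * c) = (a * b + b * a) * c

/-- The Jacobian `J(a,b,c) = (ab)c + (bc)a + (ca)b`. -/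
def jacobian {B : Type*} [NonUnitalNonAssocRing B] (a b c : B) : B :=
  (a * b) * c + (b * c) * a + (c * a) * b

/-- Tortkara algebras: anticommutative algebras with `(ab)(cb) = J(a,b,c)b`. -/
def IsTortkara (B : Type*) [NonUnitalNonAssocRing B] : Prop :=
  (∀ a b : B, a * b = -(b * a)) ∧
    ∀ a b c : B, (a * b) * (c * b) = jacobian a b c * b

/-! ### The minus algebra -/

/-- The minus algebra `A⁽⁻⁾`: the space `A` with product the commutator `[a, b] = a ∘ b - b ∘ a`. -/
def Minus (A : Type*) : Type _ := A

namespace Minus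

/-- An element of `A`, seen in `A⁽⁻⁾`. -/
def of {A : Type*} (a : A) : Minus A := a

/-- An element of `A⁽⁻⁾`, seen in `A`. -/
def val {A : Type*} (a : Minus A) : A := a

instance (A : Type*) [NonUnitalNonAssocRing A] : AddCommGroup (Minus A) :=
  inferInstanceAs (AddCommGroup A)

instance (K A : Type*) [Semiring K] [NonUnitalNonAssocRing A] [Module K A] : Module K (Minus A) :=
  inferInstanceAs (Module K A)

instance (A : Type*) [NonUnitalNonAssocRing A] : Mul (Minus A) :=
  ⟨fun a b => of (val a * val b - val b * val a)⟩

theorem mul_def {A : Type*} [NonUnitalNonAssocRing A] (a b : Minus A) :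
    a * b = of (val a * val b - val b * val a) := rfl

instance (A : Type*) [NonUnitalNonAssocRing A] : NonUnitalNonAssocRing (Minus A) :=
  { (inferInstance : AddCommGroup (Minus A)), (inferInstance : Mul (Minus A)) with
    left_distrib := fun a b c => by
      change (val a * (val b + val c) - (val b + val c) * val a : A) =
        (val a * val b - val b * val a) + (val a * val c - val c * val a)
      rw [mul_add, add_mul]; abel
    right_distrib := fun a b c => by
      change ((val a + val b) * val c - val c * (val a + val b) : A) =
        (val a * val c - val c * val a) + (val b * val c - val c * val b)
      rw [mul_add, add_mul]; abel
    zero_mul := fun a => by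
      change ((0 : A) * val a - val a * (0 : A) : A) = 0
      simp
    mul_zero := fun a => by
      change (val a * (0 : A) - (0 : A) * val a : A) = 0
      simp }

instance (K A : Type*) [Semiring K] [NonUnitalNonAssocRing A] [Module K A] [IsScalarTower K A A]
    [SMulCommClass K A A] : IsScalarTower K (Minus A) (Minus A) :=
  ⟨fun k a b => by
    change ((k • val a) * val b - val b * (k • val a) : A) = k • (val a * val b - val b * val a)
    rw [smul_mul_assoc, mul_smul_comm, smul_sub]⟩

instance (K A : Type*) [Semiring K] [NonUnitalNonAssocRing A] [Module K A] [IsScalarTower K A A]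
    [SMulCommClass K A A] : SMulCommClass K (Minus A) (Minus A) :=
  ⟨fun k a b => by
    change k • (val a * val b - val b * val a : A) = (val a * (k • val b) - (k • val b) * val a)
    rw [smul_mul_assoc, mul_smul_comm, smul_sub]⟩

end Minus

/-- A `K`-algebra `B` is special if it is isomorphic to a subalgebra of `A⁽⁻⁾` for some Zinbiel
`K`-algebra `A`. `w` is the universe
in which `A` is sought. -/
def IsSpecial (K : Type u) (B : Type v) [Field K] [NonUnitalNonAssocRing B] [Module K B] : Prop :=
  ∃ (A : Type w) (_ : NonUnitalNonAssocRing A) (_ : Module K A) (_ : IsScalarTower K A A)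
    (_ : SMulCommClass K A A), IsZinbiel A ∧
      ∃ f : B →ₙₐ[K] Minus A, Function.Injective f

/-! ### Ideals and quotients -/

/-- Two-sided ideals of a `K`-algebra: subspaces stable under multiplication by all elements of the
algebra on both sides. -/
structure AlgIdeal (K A : Type*) [Field K] [NonUnitalNonAssocRing A] [Module K A]
    extends Submodule K A where
  mul_mem_left : ∀ (a : A) {b : A}, b ∈ carrier → a * b ∈ carrier
  mul_mem_right : ∀ (a : A) {b : A}, b ∈ carrier → b * a ∈ carrier

namespace AlgIdeal

variable {K A : Type*} [Field K] [NonUnitalNonAssocRing A] [Module K A]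

/-- The ideal generated by a set: the intersection of all ideals containing it. -/
def span (K : Type*) {A : Type*} [Field K] [NonUnitalNonAssocRing A] [Module K A] (s : Set A) :
    AlgIdeal K A where
  toSubmodule := sInf {M : Submodule K A | ∃ I : AlgIdeal K A, s ⊆ I.carrier ∧ M = I.toSubmodule}
  mul_mem_left := by
    intro a b hb
    refine Submodule.mem_sInf.2 ?_
    rintro M ⟨I, hI, rfl⟩
    exact I.mul_mem_left a (Submodule.mem_sInf.1 hb _ ⟨I, hI, rfl⟩)
  mul_mem_right := by
    intro a b hb
    refine Submodule.mem_sInf.2 ?_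
    rintro M ⟨I, hI, rfl⟩
    exact I.mul_mem_right a (Submodule.mem_sInf.1 hb _ ⟨I, hI, rfl⟩)

theorem subset_span (s : Set A) : s ⊆ (span K s).carrier := by
  intro a ha
  refine Submodule.mem_sInf.2 ?_
  rintro M ⟨I, hI, rfl⟩
  exact hI ha

/-- The quotient algebra `A / I`. -/
def Quotient (I : AlgIdeal K A) : Type _ := A ⧸ I.toSubmodule

variable (I : AlgIdeal K A)

instance : AddCommGroup I.Quotient := inferInstanceAs (AddCommGroup (A ⧸ I.toSubmodule))

instance : Module K I.Quotient := inferInstanceAs (Module K (A ⧸ I.toSubmodule))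

/-- The projection `A → A / I`. -/
def proj : A →ₗ[K] I.Quotient := I.toSubmodule.mkQ

theorem proj_surjective : Function.Surjective I.proj := Submodule.mkQ_surjective _

theorem proj_eq_proj {a b : A} : I.proj a = I.proj b ↔ a - b ∈ I.toSubmodule :=
  Submodule.Quotient.eq _

instance : Mul I.Quotient :=
  ⟨Quotient.map₂ (· * ·) (by
    intro a a' ha b b' hb
    rw [← Quotient.eq_iff_equiv] at ha hb ⊢
    have ha' : a - a' ∈ I.toSubmodule := I.proj_eq_proj.1 ha
    have hb' : b - b' ∈ I.toSubmodule := I.proj_eq_proj.1 hb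
    refine I.proj_eq_proj.2 ?_
    have h : a * b - a' * b' = (a - a') * b + a' * (b - b') := by
      rw [sub_mul, mul_sub]; abel
    rw [h]
    exact add_mem (I.mul_mem_right b ha') (I.mul_mem_left a' hb'))⟩

theorem proj_mul (a b : A) : I.proj (a * b) = I.proj a * I.proj b := rfl

instance : NonUnitalNonAssocRing I.Quotient :=
  { (inferInstance : AddCommGroup I.Quotient), (inferInstance : Mul I.Quotient) with
    left_distrib := by
      intro a b c
      obtain ⟨a, rfl⟩ := I.proj_surjective a
      obtain ⟨b, rfl⟩ := I.proj_surjective b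
      obtain ⟨c, rfl⟩ := I.proj_surjective c
      rw [← map_add, ← proj_mul, ← proj_mul, ← proj_mul, ← map_add, mul_add]
    right_distrib := by
      intro a b c
      obtain ⟨a, rfl⟩ := I.proj_surjective a
      obtain ⟨b, rfl⟩ := I.proj_surjective b
      obtain ⟨c, rfl⟩ := I.proj_surjective c
      rw [← map_add, ← proj_mul, ← proj_mul, ← proj_mul, ← map_add, add_mul]
    zero_mul := by
      intro a
      obtain ⟨a, rfl⟩ := I.proj_surjective a
      rw [← map_zero I.proj, ← proj_mul, zero_mul]
    mul_zero := by
      intro a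
      obtain ⟨a, rfl⟩ := I.proj_surjective a
      rw [← map_zero I.proj, ← proj_mul, mul_zero] }

instance [IsScalarTower K A A] : IsScalarTower K I.Quotient I.Quotient :=
  ⟨by
    intro k a b
    obtain ⟨a, rfl⟩ := I.proj_surjective a
    obtain ⟨b, rfl⟩ := I.proj_surjective b
    change I.proj (k • a) * I.proj b = k • I.proj (a * b)
    rw [← proj_mul, smul_mul_assoc, map_smul]⟩

instance [SMulCommClass K A A] : SMulCommClass K I.Quotient I.Quotient :=
  ⟨by
    intro k a b
    obtain ⟨a, rfl⟩ := I.proj_surjective a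
    obtain ⟨b, rfl⟩ := I.proj_surjective b
    change k • I.proj (a * b) = I.proj a * I.proj (k • b)
    rw [← proj_mul, mul_smul_comm, map_smul]⟩

end AlgIdeal

/-! ### The free Zinbiel algebra -/

/-- All values of the Zinbiel identity in the free nonassociative algebra on `X`. -/
def zinbielRelations (K X : Type*) [Field K] : Set (FreeNonUnitalNonAssocAlgebra K X) :=
  {t | ∃ a b c : FreeNonUnitalNonAssocAlgebra K X, t = a * (b * c) - (a * b + b * a) * c}

/-- The free Zinbiel algebra `Zin(X)`: the free nonassociative algebra on `X` modulo the ideal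
generated by all values of the Zinbiel identity. -/
abbrev Zin (K X : Type*) [Field K] : Type _ :=
  (AlgIdeal.span K (zinbielRelations K X)).Quotient

namespace Zin

variable (K : Type*) {X : Type*} [Field K]

/-- The free generators of `Zin(X)`. -/
noncomputable def gen (x : X) : Zin K X :=
  AlgIdeal.proj _ (FreeNonUnitalNonAssocAlgebra.of K x)

theorem isZinbiel (X : Type*) : IsZinbiel (Zin K X) := by
  intro a b c
  obtain ⟨a, rfl⟩ := AlgIdeal.proj_surjective _ a
  obtain ⟨b, rfl⟩ := AlgIdeal.proj_surjective _ b
  obtain ⟨c, rfl⟩ := AlgIdeal.proj_surjective _ c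
  simp only [← AlgIdeal.proj_mul, ← map_add]
  exact (AlgIdeal.proj_eq_proj _).2 (AlgIdeal.subset_span _ ⟨a, b, c, rfl⟩)

/-- The left-bracketed monomial `x₁x₂⋯xₙ = (⋯(x₁ ∘ x₂)⋯) ∘ xₙ` (and `0` for the empty list). -/
noncomputable def monomial : List X → Zin K X
  | [] => 0
  | x :: l => l.foldl (fun w y => w * gen K y) (gen K x)

/-- The element `u a b - u b a`, where `u` is a word in the letters, that is, the difference of the
monomial `u a b` and the monomial with its last two letters exchanged. The skew-right-commutative
(skew-rcom) elements are those with `a < b`, for a given linear order on `X`. -/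
noncomputable def skewRcom (u : List X) (a b : X) : Zin K X :=
  monomial K (u ++ [a, b]) - monomial K (u ++ [b, a])

end Zin

/-! ### The free special Tortkara algebra -/

/-- The free special Tortkara algebra `ST(X)`: the subalgebra of `Zin(X)⁽⁻⁾` generated by `X`. -/
noncomputable def FreeSpecialTortkara (K X : Type*) [Field K] :
    NonUnitalSubalgebra K (Minus (Zin K X)) :=
  NonUnitalAlgebra.adjoin K (Set.range fun x : X => Minus.of (Zin.gen K x))

theorem skewRcom_mem_freeSpecialTortkara (K : Type*) {X : Type*} [Field K] [CharZero K]
    (a b c : X) :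
    Minus.of (Zin.skewRcom K [a] b c) ∈ FreeSpecialTortkara K X := by
  have hg : ∀ x : X, Minus.of (Zin.gen K x) ∈ FreeSpecialTortkara K X := fun x =>
    NonUnitalAlgebra.subset_adjoin K ⟨x, rfl⟩
  have key : Minus.of (Zin.skewRcom K [a] b c) =
      (2⁻¹ : K) • (Minus.of (Zin.gen K a) * Minus.of (Zin.gen K b) * Minus.of (Zin.gen K c) +
        Minus.of (Zin.gen K b) * (Minus.of (Zin.gen K a) * Minus.of (Zin.gen K c))) := by
    have h2 : (2 : K) ≠ 0 := two_ne_zero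
    rw [eq_inv_smul_iff₀ h2, two_smul]
    have hz := Zin.isZinbiel K X
    set x := Zin.gen K a with hx
    set y := Zin.gen K b with hy
    set z := Zin.gen K c with hzz
    change ((x * y) * z - (x * z) * y) + ((x * y) * z - (x * z) * y) =
      (((x * y - y * x) * z - z * (x * y - y * x)) +
        (y * (x * z - z * x) - (x * z - z * x) * y) : Zin K X)
    simp only [mul_sub, sub_mul]
    rw [hz z x y, hz z y x, hz y x z, hz y z x]
    simp only [add_mul]
    abel
  rw [key]
  exact SMulMemClass.smul_mem _ (add_mem (mul_mem (mul_mem (hg a) (hg b)) (hg c))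
    (mul_mem (hg b) (mul_mem (hg a) (hg c))))

/-- For letters `a, b, c`, the element `abc - acb`, as an element of `ST(X)`. -/
noncomputable def FreeSpecialTortkara.skew (K : Type*) {X : Type*} [Field K] [CharZero K]
    (a b c : X) : FreeSpecialTortkara K X :=
  ⟨Minus.of (Zin.skewRcom K [a] b c), skewRcom_mem_freeSpecialTortkara K a b c⟩

/-- The ideal of `ST({x, y, z})` generated by the skew-rcom elements `yyz - yzy`, `yxz - yzx` and
`yxy - yyx`, where `x, y, z` are the letters `0, 1, 2` of `Fin 3`. -/
noncomputable def exceptionalIdeal (K : Type*) [Field K] [CharZero K] :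
    AlgIdeal K (FreeSpecialTortkara K (Fin 3)) :=
  AlgIdeal.span K
    {FreeSpecialTortkara.skew K 1 1 2, FreeSpecialTortkara.skew K 1 0 2,
      FreeSpecialTortkara.skew K 1 0 1}

/-! Zin(X) is the space of words, with u ∘ (v a) = (u ∘ v + v ∘ u) a for a last letter a, and u ∘ v
+ v ∘ u = u ш v is the shuffle. As `Zin` is defined by a quotient, the letter derivatives
`Zin.deriv` supply the unique decomposition by last letters.

Two generators. Put w = xy − yx, let I be the kernel inside ST(x, y), and let J (`rightHull`) be the
span of all f t with f ∈ I and t a word. If J is an ideal of Zin(x, y) with J ∩ ST = I, then ST/I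
embeds in (Zin/J)⁽⁻⁾. Elements of ST are skew in their last two letters, hence of the form αx + βy +
v w (`exists_of_mem_skewElements`). As [a, f] = a ш f − 2 f a, one has [y, [x, f]] − [x, [y, f]] = 2
f w, and an induction yields f t w ∈ I for every word t (`appendSkew_word_mem`). That g ∘ f ∈ J for
f ∈ I is proved by induction on the degree of g: it suffices to treat g = v w, which lies in ST, and
shuffles of a letter with a shorter word (`wordSpan_le`). For J ∩ ST = I, comparing last letters
reduces the claim to: if ux, uy ∈ J then u w ∈ I (`appendSkew_mem_of_append_mem`). There u is a
polynomial in y modulo J, whose terms are separated by shuffling with y.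

Three generators. The element yxzy − yxyz + yzyx − yzxy + yyxz − yyzx equals (yxz − yzx)y − (yxy −
yyx)z − (yyz − yzy)x, so it vanishes in every Zinbiel algebra in which the three generators of α
vanish. Four times it lies in ST, but not in α: in degree four α consists of commutators of letters
with its generators, and `separatingForm` kills these. -/

/-- The minus algebra of a Zinbiel algebra is a Tortkara algebra. -/
theorem IsZinbiel.isTortkara_minus {A : Type*} [NonUnitalNonAssocRing A] (h : IsZinbiel A) :
    IsTortkara (Minus A) := by
  have h' : ∀ a b c : A, a * (b * c) = a * b * c + b * a * c := fun a b c => by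
    rw [h, add_mul]
  constructor
  · intro a b
    exact (neg_sub _ _).symm
  · intro a b c
    let a' : A := a
    let b' : A := b
    let c' : A := c
    change (a' * b' - b' * a') * (c' * b' - b' * c') - (c' * b' - b' * c') * (a' * b' - b' * a') =
      (((a' * b' - b' * a') * c' - c' * (a' * b' - b' * a') +
        ((b' * c' - c' * b') * a' - a' * (b' * c' - c' * b')) +
        ((c' * a' - a' * c') * b' - b' * (c' * a' - a' * c'))) * b' -
      b' * ((a' * b' - b' * a') * c' - c' * (a' * b' - b' * a') +
        ((b' * c' - c' * b') * a' - a' * (b' * c' - c' * b')) +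
        ((c' * a' - a' * c') * b' - b' * (c' * a' - a' * c'))))
    simp only [mul_sub, sub_mul, mul_add, add_mul, h']
    abel

/-! ### Universal property of Zin(X) and spanning by words. -/

namespace Zin

section Lift

variable {K : Type*} {X : Type*} [Field K] {A : Type*} [NonUnitalNonAssocRing A] [Module K A]
  [IsScalarTower K A A] [SMulCommClass K A A]

/-- The kernel of an algebra homomorphism, as an ideal. -/
def kerIdeal {B : Type*} [NonUnitalNonAssocRing B] [Module K B] (φ : B →ₙₐ[K] A) :
    AlgIdeal K B where
  toSubmodule := LinearMap.ker (φ : B →ₗ[K] A)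
  mul_mem_left := by
    intro a b hb
    have hb' : φ b = 0 := hb
    change φ (a * b) = 0
    rw [map_mul, hb', mul_zero]
  mul_mem_right := by
    intro a b hb
    have hb' : φ b = 0 := hb
    change φ (b * a) = 0
    rw [map_mul, hb', zero_mul]

theorem span_le_of_subset {B : Type*} [NonUnitalNonAssocRing B] [Module K B] {s : Set B}
    {I : AlgIdeal K B} (h : s ⊆ I.carrier) : (AlgIdeal.span K s).toSubmodule ≤ I.toSubmodule :=
  fun _ hb => Submodule.mem_sInf.1 hb _ ⟨I, h, rfl⟩

/-- The universal property of the free Zinbiel algebra. -/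
noncomputable def lift (hA : IsZinbiel A) (g : X → A) : Zin K X →ₙₐ[K] A :=
  let φ := FreeNonUnitalNonAssocAlgebra.lift K g
  let L : Zin K X →ₗ[K] A :=
    (AlgIdeal.span K (zinbielRelations K X)).toSubmodule.liftQ (φ : _ →ₗ[K] A) (by
      refine span_le_of_subset (I := kerIdeal φ) ?_
      rintro _ ⟨a, b, c, rfl⟩
      change φ _ = 0
      rw [map_sub, map_mul, map_mul, map_mul, map_add, map_mul, map_mul, hA, sub_self])
  { toFun := L
    map_smul' := fun c a => L.map_smul c a
    map_zero' := L.map_zero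
    map_add' := L.map_add
    map_mul' := by
      intro a b
      obtain ⟨a, rfl⟩ := AlgIdeal.proj_surjective _ a
      obtain ⟨b, rfl⟩ := AlgIdeal.proj_surjective _ b
      exact map_mul φ a b }

theorem lift_gen (hA : IsZinbiel A) (g : X → A) (x : X) : lift (K := K) hA g (gen K x) = g x :=
  FreeNonUnitalNonAssocAlgebra.lift_of_apply K g x

theorem hom_ext {f g : Zin K X →ₙₐ[K] A} (h : ∀ x, f (gen K x) = g (gen K x)) : f = g := by
  let π : FreeNonUnitalNonAssocAlgebra K X →ₙₐ[K] Zin K X :=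
    { toFun := AlgIdeal.proj _
      map_smul' := fun c a => map_smul (AlgIdeal.proj _) c a
      map_zero' := map_zero (AlgIdeal.proj _)
      map_add' := map_add (AlgIdeal.proj _)
      map_mul' := fun _ _ => rfl }
  have hπ : f.comp π = g.comp π := FreeNonUnitalNonAssocAlgebra.hom_ext K h
  ext a
  obtain ⟨a, rfl⟩ := AlgIdeal.proj_surjective _ a
  exact DFunLike.congr_fun hπ a

/-- The left-bracketed monomials of `Zin(X)`. -/
inductive IsMonomial : Zin K X → Prop
  | gen (x : X) : IsMonomial (gen K x)
  | mul_gen {u : Zin K X} (hu : IsMonomial u) (x : X) : IsMonomial (u * gen K x)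

/-- The identity u ∘ (v a) = (u ∘ v + v ∘ u) a strips last letters. Both orders of the product
appear on the right, so the induction carries a * b and b * a together. -/
theorem mul_mem_span_isMonomial {u v : Zin K X}
    (hu : u ∈ Submodule.span K {z : Zin K X | IsMonomial z})
    (hv : v ∈ Submodule.span K {z : Zin K X | IsMonomial z}) :
    u * v ∈ Submodule.span K {z : Zin K X | IsMonomial z} := by
  set U := Submodule.span K {z : Zin K X | IsMonomial z} with hU
  have hR : ∀ u ∈ U, ∀ x, u * gen K x ∈ U := by
    intro u hu x
    have : U ≤ U.comap (LinearMap.mulRight K (gen K x)) :=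
      Submodule.span_le.2 fun a ha => Submodule.subset_span (.mul_gen ha x)
    exact this hu
  have hz := isZinbiel K X
  have key : ∀ b : Zin K X, IsMonomial b → ∀ a, IsMonomial a → a * b ∈ U ∧ b * a ∈ U := by
    intro b hb
    induction hb with
    | gen x =>
      intro a ha
      refine ⟨hR _ (Submodule.subset_span ha) x, ?_⟩
      induction ha with
      | gen y => exact hR _ (Submodule.subset_span (.gen x)) y
      | mul_gen ha y ih =>
        rw [hz]
        exact hR _ (add_mem ih (hR _ (Submodule.subset_span ha) x)) y
    | @mul_gen b hb x ih =>
      intro a ha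
      refine ⟨?_, ?_⟩
      · rw [hz]
        exact hR _ (add_mem (ih a ha).1 (ih a ha).2) x
      · induction ha with
        | gen y => exact hR _ (Submodule.subset_span (.mul_gen hb x)) y
        | @mul_gen a ha y ih' =>
          rw [hz]
          refine hR _ (add_mem ih' ?_) y
          rw [hz]
          exact hR _ (add_mem (ih a ha).1 (ih a ha).2) x
  induction hu, hv using Submodule.span_induction₂ with
  | mem_mem a b ha hb => exact (key b hb a ha).1
  | zero_left => simp
  | zero_right => simp
  | add_left a b c _ _ _ h1 h2 => rw [add_mul]; exact add_mem h1 h2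
  | add_right a b c _ _ _ h1 h2 => rw [mul_add]; exact add_mem h1 h2
  | smul_left r a b _ _ h => rw [smul_mul_assoc]; exact Submodule.smul_mem _ _ h
  | smul_right r a b _ _ h => rw [mul_smul_comm]; exact Submodule.smul_mem _ _ h

/-- The span is a Zinbiel subalgebra containing the generators; lifting into it and including back
is the identity. -/
theorem span_isMonomial : Submodule.span K {z : Zin K X | IsMonomial z} = ⊤ := by
  let S : NonUnitalSubalgebra K (Zin K X) :=
    { Submodule.span K {z : Zin K X | IsMonomial z} with
      mul_mem' := fun ha hb => mul_mem_span_isMonomial ha hb }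
  have hS : IsZinbiel S := fun a b c => Subtype.ext (isZinbiel K X a b c)
  let g : X → S := fun x => ⟨gen K x, Submodule.subset_span (.gen x)⟩
  have h : (NonUnitalSubalgebraClass.subtype S).comp (lift hS g) = NonUnitalAlgHom.id K _ :=
    hom_ext fun x => congrArg Subtype.val (lift_gen hS g x)
  rw [eq_top_iff]
  intro z _
  have hz : ((lift hS g z : S) : Zin K X) = z := DFunLike.congr_fun h z
  rw [← hz]
  exact (lift hS g z).2

/-- A subspace of `Zin(X)` containing the generators and stable under right multiplication by them
is everything. -/
theorem mem_of_mul_gen_mem {U : Submodule K (Zin K X)} (h1 : ∀ x, gen K x ∈ U)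
    (h2 : ∀ u ∈ U, ∀ x, u * gen K x ∈ U) (z : Zin K X) : z ∈ U := by
  have h : Submodule.span K {z : Zin K X | IsMonomial z} ≤ U := by
    refine Submodule.span_le.2 fun a ha => ?_
    induction ha with
    | gen x => exact h1 x
    | mul_gen _ x ih => exact h2 _ ih x
  rw [span_isMonomial] at h
  exact h trivial

end Lift

/-! ### Letter derivatives -/

section Derivative

variable {K : Type*} {X : Type*} [Field K]

/-- The shuffle product of an element of a Zinbiel algebra and an element of its unitization. -/
def shuffle {A : Type*} [NonUnitalNonAssocRing A] [Module K A] (a : A) (t : K × A) : A :=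
  t.1 • a + (a * t.2 + t.2 * a)

/-- The family of all candidates for the letter derivatives of an element of `Zin(X)`. -/
def Gradient (K X : Type*) [Field K] : Type _ := X → K × Zin K X

namespace Gradient

noncomputable instance : AddCommGroup (Gradient K X) :=
  inferInstanceAs (AddCommGroup (X → K × Zin K X))

noncomputable instance : Module K (Gradient K X) := inferInstanceAs (Module K (X → K × Zin K X))

variable [Fintype X]

/-- The element of `Zin(X)` with the given gradient. -/
noncomputable def total : Gradient K X →ₗ[K] Zin K X where
  toFun G := ∑ a, ((G a).1 • gen K a + (G a).2 * gen K a)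
  map_add' F G := by
    rw [← Finset.sum_add_distrib]
    refine Finset.sum_congr rfl fun a _ => ?_
    change ((F a).1 + (G a).1) • gen K a + ((F a).2 + (G a).2) * gen K a = _
    rw [add_smul, add_mul]
    abel
  map_smul' c G := by
    rw [Finset.smul_sum]
    refine Finset.sum_congr rfl fun a _ => ?_
    change (c • (G a).1) • gen K a + (c • (G a).2) * gen K a = _
    rw [smul_assoc, smul_mul_assoc, ← smul_add]
    rfl

/-- The rule ∂ₐ(u ∘ v) = u ш ∂ₐv is built into the product, so that the universal property produces
the derivatives. -/
noncomputable instance : Mul (Gradient K X) :=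
  ⟨fun F G a => (0, shuffle (total F) (G a))⟩

theorem mul_apply (F G : Gradient K X) (a : X) : (F * G) a = (0, shuffle (total F) (G a)) := rfl

noncomputable instance : NonUnitalNonAssocRing (Gradient K X) :=
  { (inferInstance : AddCommGroup (Gradient K X)), (inferInstance : Mul (Gradient K X)) with
    left_distrib := fun F G H => funext fun a => by
      change ((0 : K), shuffle (total F) (G a + H a)) =
        (0, shuffle (total F) (G a)) + (0, shuffle (total F) (H a))
      refine Prod.ext (add_zero 0).symm ?_
      change ((G a).1 + (H a).1) • total F +
          (total F * ((G a).2 + (H a).2) + ((G a).2 + (H a).2) * total F) =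
        (G a).1 • total F + (total F * (G a).2 + (G a).2 * total F) +
          ((H a).1 • total F + (total F * (H a).2 + (H a).2 * total F))
      simp only [add_smul, mul_add, add_mul]
      abel
    right_distrib := fun F G H => funext fun a => by
      change ((0 : K), shuffle (total (F + G)) (H a)) =
        (0, shuffle (total F) (H a)) + (0, shuffle (total G) (H a))
      rw [Prod.mk_add_mk, add_zero]
      simp only [shuffle, map_add, smul_add, mul_add, add_mul]
      congr 1
      abel
    zero_mul := fun F => funext fun a => by
      change ((0 : K), shuffle (total 0) (F a)) = 0
      simp [shuffle]
    mul_zero := fun F => funext fun a => by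
      change ((0 : K), shuffle (total F) 0) = 0
      simp [shuffle] }

noncomputable instance : IsScalarTower K (Gradient K X) (Gradient K X) :=
  ⟨fun k F G => funext fun a => by
    change ((0 : K), shuffle (total (k • F)) (G a)) = k • (0, shuffle (total F) (G a))
    rw [Prod.smul_mk, smul_zero]
    simp only [shuffle, map_smul, smul_add, smul_mul_assoc, mul_smul_comm]
    rw [smul_comm]⟩

noncomputable instance : SMulCommClass K (Gradient K X) (Gradient K X) :=
  ⟨fun k F G => funext fun a => by
    change k • ((0 : K), shuffle (total F) (G a)) = (0, shuffle (total F) (k • G a))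
    rw [Prod.smul_mk, smul_zero]
    simp only [shuffle, Prod.smul_fst, Prod.smul_snd, smul_add, smul_mul_assoc, mul_smul_comm,
      smul_assoc]⟩

theorem total_mul (F G : Gradient K X) : total (F * G) = total F * total G := by
  change ∑ a, (((F * G) a).1 • gen K a + ((F * G) a).2 * gen K a) =
    total F * ∑ a, ((G a).1 • gen K a + (G a).2 * gen K a)
  rw [Finset.mul_sum]
  refine Finset.sum_congr rfl fun a _ => ?_
  rw [mul_apply, zero_smul, zero_add, mul_add, isZinbiel K X, mul_smul_comm, shuffle, add_mul,
    smul_mul_assoc]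

theorem isZinbiel : IsZinbiel (Gradient K X) := by
  intro F G H
  refine funext fun a => ?_
  have h' : ∀ a b c : Zin K X, a * (b * c) = a * b * c + b * a * c := fun a b c => by
    rw [Zin.isZinbiel K X, add_mul]
  simp only [mul_apply, map_add, total_mul, shuffle, zero_smul, zero_add, mul_add, add_mul, smul_add,
    mul_smul_comm, smul_mul_assoc, h']
  congr 1
  abel

/-- The gradient of a generator. -/
noncomputable def single [DecidableEq X] (x : X) : Gradient K X :=
  fun a => if a = x then (1, 0) else 0

/-- The homomorphism sending an element of `Zin(X)` to its gradient. -/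
noncomputable def grad [DecidableEq X] : Zin K X →ₙₐ[K] Gradient K X :=
  lift isZinbiel single

theorem total_grad [DecidableEq X] (z : Zin K X) : total (grad z) = z := by
  let τ : Gradient K X →ₙₐ[K] Zin K X :=
    { toFun := total
      map_smul' := fun c a => map_smul total c a
      map_zero' := map_zero total
      map_add' := map_add total
      map_mul' := total_mul }
  have h : τ.comp grad = NonUnitalAlgHom.id K _ := by
    refine hom_ext fun x => ?_
    change total (grad (gen K x)) = gen K x
    rw [grad, lift_gen]
    change ∑ a, ((single x a).1 • gen K a + (single x a).2 * gen K a) = gen K x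
    rw [Finset.sum_eq_single x]
    · simp [single]
    · intro b _ hb
      simp [single, hb]
    · simp
  exact DFunLike.congr_fun h z

end Gradient

/-- The letter derivative `∂ₐ` of `Zin(X)`, with values in its unitization: every `z` is the sum
of the `(∂ₐ z) a`. -/
noncomputable def deriv [Fintype X] [DecidableEq X] (a : X) : Zin K X →ₗ[K] K × Zin K X where
  toFun z := Gradient.grad z a
  map_add' u v := congrFun (map_add Gradient.grad u v) a
  map_smul' c u := congrFun (map_smul Gradient.grad c u) a

variable [Fintype X] [DecidableEq X]

theorem deriv_gen (a b : X) :
    deriv a (gen K b) = if a = b then ((1, 0) : K × Zin K X) else 0 := by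
  change Gradient.grad (gen K b) a = _
  rw [Gradient.grad, lift_gen]
  rfl

theorem deriv_mul (a : X) (u v : Zin K X) :
    deriv a (u * v) = ((0, shuffle u (deriv a v)) : K × Zin K X) := by
  change Gradient.grad (u * v) a = _
  rw [map_mul, Gradient.mul_apply, Gradient.total_grad]
  rfl

theorem eq_sum_deriv (z : Zin K X) :
    z = ∑ a, ((deriv a z).1 • gen K a + (deriv a z).2 * gen K a) :=
  (Gradient.total_grad z).symm

end Derivative

end Zin

/-! ### Three generators -/

/-- Tortkara algebras are stable under quotients. -/
theorem AlgIdeal.isTortkara_quotient {K A : Type*} [Field K] [NonUnitalNonAssocRing A] [Module K A]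
    (I : AlgIdeal K A) (h : IsTortkara A) : IsTortkara I.Quotient := by
  constructor
  · intro a b
    obtain ⟨a, rfl⟩ := I.proj_surjective a
    obtain ⟨b, rfl⟩ := I.proj_surjective b
    rw [← I.proj_mul, ← I.proj_mul, h.1 a b, map_neg]
  · intro a b c
    obtain ⟨a, rfl⟩ := I.proj_surjective a
    obtain ⟨b, rfl⟩ := I.proj_surjective b
    obtain ⟨c, rfl⟩ := I.proj_surjective c
    simp only [jacobian, ← I.proj_mul, ← map_add]
    rw [h.2 a b c, jacobian]

theorem FreeSpecialTortkara.isTortkara (K X : Type*) [Field K] :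
    IsTortkara (FreeSpecialTortkara K X) := by
  have h := (Zin.isZinbiel K X).isTortkara_minus
  exact ⟨fun a b => Subtype.ext (h.1 a b), fun a b c => Subtype.ext (h.2 a b c)⟩

namespace Zin

variable {K : Type*} {X : Type*} [Field K] [Fintype X] [DecidableEq X]

/-- The coefficient of the letter `a`. -/
noncomputable def coeff (a : X) : Zin K X →ₗ[K] K := LinearMap.fst K K _ ∘ₗ deriv a

/-- The linear map deleting a last letter `a`. -/
noncomputable def dropLast (a : X) : Zin K X →ₗ[K] Zin K X := LinearMap.snd K K _ ∘ₗ deriv a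

theorem coeff_gen (a b : X) : coeff a (gen K b) = if a = b then 1 else 0 := by
  change (deriv a (gen K b)).1 = _
  rw [deriv_gen]
  split_ifs <;> rfl

theorem dropLast_gen (a b : X) : dropLast a (gen K b) = 0 := by
  change (deriv a (gen K b)).2 = _
  rw [deriv_gen]
  split_ifs <;> rfl

theorem coeff_mul (a : X) (u v : Zin K X) : coeff a (u * v) = 0 := by
  change (deriv a (u * v)).1 = _
  rw [deriv_mul]

theorem dropLast_mul (a : X) (u v : Zin K X) :
    dropLast a (u * v) = coeff a v • u + (u * dropLast a v + dropLast a v * u) := by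
  change (deriv a (u * v)).2 = _
  rw [deriv_mul]
  rfl

/-- The elements of `Zin(X)` without terms of degree at most `n`. -/
noncomputable def degreeGT (K X : Type*) [Field K] [Fintype X] [DecidableEq X] :
    ℕ → Submodule K (Zin K X)
  | 0 => ⊤
  | n + 1 => ⨅ a, LinearMap.ker (coeff a) ⊓ (degreeGT K X n).comap (dropLast a)

theorem mem_degreeGT_succ {n : ℕ} {u : Zin K X} :
    u ∈ degreeGT K X (n + 1) ↔ ∀ a, coeff a u = 0 ∧ dropLast a u ∈ degreeGT K X n := by
  simp [degreeGT]

theorem degreeGT_succ_le (n : ℕ) : degreeGT K X (n + 1) ≤ degreeGT K X n := by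
  induction n with
  | zero => exact le_top
  | succ n ih =>
    intro u hu
    rw [mem_degreeGT_succ] at hu ⊢
    exact fun a => ⟨(hu a).1, ih (hu a).2⟩

/-- Degrees at least i + 1 and j + 1 add up to at least i + j + 2, whence the shift by one. -/
theorem mul_mem_degreeGT (n : ℕ) : ∀ i j : ℕ, i + j = n → ∀ u ∈ degreeGT K X i,
    ∀ v ∈ degreeGT K X j, u * v ∈ degreeGT K X (n + 1) := by
  induction n with
  | zero =>
    intro i j _ u _ v _
    rw [mem_degreeGT_succ]
    exact fun a => ⟨coeff_mul a u v, trivial⟩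
  | succ n ih =>
    intro i j hij u hu v hv
    rw [mem_degreeGT_succ]
    refine fun a => ⟨coeff_mul a u v, ?_⟩
    rw [dropLast_mul]
    cases j with
    | zero =>
      obtain rfl : i = n + 1 := hij
      exact add_mem (Submodule.smul_mem _ _ hu)
        (add_mem (ih n 0 rfl _ (degreeGT_succ_le n hu) _ trivial)
          (ih 0 n (zero_add n) _ trivial _ (degreeGT_succ_le n hu)))
    | succ j =>
      obtain ⟨h1, h2⟩ := mem_degreeGT_succ.1 hv a
      rw [h1, zero_smul, zero_add]
      exact add_mem (ih i j (by omega) _ hu _ h2) (ih j i (by omega) _ h2 _ hu)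

/-- The part of `z` of degree at least two. -/
theorem sub_sum_coeff_mem (z : Zin K X) :
    z - ∑ a, coeff a z • gen K a ∈ degreeGT K X 1 := by
  rw [mem_degreeGT_succ]
  refine fun a => ⟨?_, trivial⟩
  simp [coeff_gen]

/-- The coefficient of the word `abcd`. -/
noncomputable def coeff₄ (a b c d : X) : Zin K X →ₗ[K] K :=
  coeff a ∘ₗ dropLast b ∘ₗ dropLast c ∘ₗ dropLast d

theorem coeff₄_eq_zero {a b c d : X} {u : Zin K X} (hu : u ∈ degreeGT K X 4) :
    coeff₄ a b c d u = 0 :=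
  (mem_degreeGT_succ.1 (mem_degreeGT_succ.1 (mem_degreeGT_succ.1
    (mem_degreeGT_succ.1 hu d).2 c).2 b).2 a).1

/-- A linear form on `Zin({x, y, z})` separating an element of degree four from the exceptional
ideal. -/
noncomputable def separatingForm (K : Type*) [Field K] : Zin K (Fin 3) →ₗ[K] K :=
  -- The words zyyx, yzyx, yyxz minus xyyz, yxyz: zero on the nine commutators of a letter with a
  -- generator of the ideal, and 3 on a quarter of `exceptionalElement`.
  coeff₄ 2 1 1 0 + coeff₄ 1 2 1 0 + coeff₄ 1 1 0 2 - coeff₄ 0 1 1 2 - coeff₄ 1 0 1 2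

theorem separatingForm_eq_zero {u : Zin K (Fin 3)} (hu : u ∈ degreeGT K (Fin 3) 4) :
    separatingForm K u = 0 := by
  simp [separatingForm, coeff₄_eq_zero hu]

/-- The commutator with `u`, as a linear map. -/
noncomputable def comm (u : Zin K X) : Zin K X →ₗ[K] Zin K X :=
  LinearMap.mulLeft K u - LinearMap.mulRight K u

omit [Fintype X] [DecidableEq X] in
theorem comm_apply (u v : Zin K X) : comm u v = u * v - v * u := rfl

theorem comm_mem_degreeGT {n i j : ℕ} (h : i + j = n) {u v : Zin K X} (hu : u ∈ degreeGT K X i)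
    (hv : v ∈ degreeGT K X j) : comm u v ∈ degreeGT K X (n + 1) :=
  sub_mem (mul_mem_degreeGT n i j h u hu v hv) (mul_mem_degreeGT n j i (by omega) v hv u hu)

/-- An auxiliary subspace of `Zin({x, y, z})`, stable under commutators. -/
noncomputable def separator (K : Type*) [Field K] : Submodule K (Zin K (Fin 3)) :=
  degreeGT K (Fin 3) 2 ⊓ LinearMap.ker (separatingForm K) ⊓
    ⨅ a, LinearMap.ker (separatingForm K ∘ₗ comm (gen K a))

theorem mem_separator {u : Zin K (Fin 3)} : u ∈ separator K ↔
    (u ∈ degreeGT K (Fin 3) 2 ∧ separatingForm K u = 0) ∧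
      ∀ a, separatingForm K (comm (gen K a) u) = 0 := by
  simp [separator]

/-- The form sees only degree four, and u starts in degree three. Hence only the linear part of g
contributes to the form of [g, u], and it contributes 0 by assumption on u; a further commutator
starts in degree five. -/
theorem comm_mem_separator (g : Zin K (Fin 3)) {u : Zin K (Fin 3)} (hu : u ∈ separator K) :
    comm g u ∈ separator K := by
  obtain ⟨⟨h1, -⟩, h3⟩ := mem_separator.1 hu
  have h0 : ∀ v : Zin K (Fin 3), v ∈ degreeGT K (Fin 3) 0 := fun _ => trivial
  have h4 : comm g u ∈ degreeGT K (Fin 3) 3 :=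
    comm_mem_degreeGT (n := 2) (zero_add 2) (h0 g) h1
  refine mem_separator.2 ⟨⟨degreeGT_succ_le 2 h4, ?_⟩, fun a =>
    separatingForm_eq_zero (comm_mem_degreeGT (n := 3) (zero_add 3) (h0 _) h4)⟩
  have h5 : comm g u = comm (g - ∑ a, coeff a g • gen K a) u +
      ∑ a, coeff a g • comm (gen K a) u := by
    simp only [comm_apply, sub_mul, mul_sub, Finset.sum_mul, Finset.mul_sum, smul_mul_assoc,
      mul_smul_comm, smul_sub, Finset.sum_sub_distrib]
    abel
  rw [h5, map_add, separatingForm_eq_zero (comm_mem_degreeGT (n := 3) (i := 1) (j := 2) rfl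
    (sub_sum_coeff_mem g) h1), map_sum,
    zero_add]
  exact Finset.sum_eq_zero fun a _ => by rw [map_smul, h3, smul_zero]

theorem skewRcom_mem_separator {b c : Fin 3}
    (h : (b, c) ∈ [((1 : Fin 3), (2 : Fin 3)), (0, 2), (0, 1)]) :
    skewRcom K [1] b c ∈ separator K := by
  have h0 : skewRcom K [1] b c = gen K 1 * gen K b * gen K c - gen K 1 * gen K c * gen K b := rfl
  rw [h0, mem_separator]
  refine ⟨⟨?_, ?_⟩, ?_⟩
  · exact sub_mem (mul_mem_degreeGT 1 1 0 rfl _ (mul_mem_degreeGT 0 0 0 rfl _ trivial _ trivial) _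
      trivial) (mul_mem_degreeGT 1 1 0 rfl _ (mul_mem_degreeGT 0 0 0 rfl _ trivial _ trivial) _
      trivial)
  · simp only [List.mem_cons, Prod.mk.injEq, List.not_mem_nil, or_false] at h
    rcases h with ⟨rfl, rfl⟩ | ⟨rfl, rfl⟩ | ⟨rfl, rfl⟩ <;>
    simp [separatingForm, coeff₄, dropLast_mul, dropLast_gen, coeff_gen]
  · intro a
    simp only [List.mem_cons, Prod.mk.injEq, List.not_mem_nil, or_false] at h
    rcases h with ⟨rfl, rfl⟩ | ⟨rfl, rfl⟩ | ⟨rfl, rfl⟩ <;> fin_cases a <;>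
    simp [separatingForm, coeff₄, comm_apply, dropLast_mul, dropLast_gen, coeff_gen, coeff_mul]

end Zin

/-- Skew elements are thus Tortkara expressions, up to the factor 2, so their vanishing passes to
any Zinbiel algebra receiving ST. -/
theorem skew_combination_minus {A : Type*} [NonUnitalNonAssocRing A] (h : IsZinbiel A)
    (x y z : A) :
    Minus.val (Minus.of x * Minus.of y * Minus.of z + Minus.of y * (Minus.of x * Minus.of z)) =
      (2 : ℕ) • (x * y * z - x * z * y) := by
  have h' : ∀ a b c : A, a * (b * c) = a * b * c + b * a * c := fun a b c => by
    rw [h, add_mul]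
  change ((x * y - y * x) * z - z * (x * y - y * x)) +
    (y * (x * z - z * x) - (x * z - z * x) * y) = _
  simp only [mul_sub, sub_mul, h']
  abel

/-- The nonassociative polynomial whose value on the letters of `Zin({x, y, z})` is four times
`yxzy - yxyz + yzyx - yzxy + yyxz - yyzx`. -/
def tortkaraWitness {B : Type*} [NonUnitalNonAssocRing B] (x y z : B) : B :=
  -- Every pair (ab)c + b(ac) evaluates to 2(abc − acb), by `skew_combination_minus`.
  y * ((y * x) * z + x * (y * z)) + y * ((z * y) * x + y * (z * x)) -
    y * ((x * y) * z + y * (x * z)) +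
  (2 : ℕ) • ((((y * z) * y) * x + y * ((y * z) * x)) - (((y * x) * y) * z + y * ((y * x) * z)))

theorem map_tortkaraWitness {K B C : Type*} [Field K] [NonUnitalNonAssocRing B] [Module K B]
    [NonUnitalNonAssocRing C] [Module K C] (f : B →ₙₐ[K] C) (x y z : B) :
    f (tortkaraWitness x y z) = tortkaraWitness (f x) (f y) (f z) := by
  simp only [tortkaraWitness, map_add, map_sub, map_mul, map_nsmul]

theorem tortkaraWitness_minus {A : Type*} [NonUnitalNonAssocRing A] (h : IsZinbiel A) (x y z : A) :
    Minus.val (tortkaraWitness (Minus.of x) (Minus.of y) (Minus.of z)) =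
      (4 : ℕ) • (y * x * z * y - y * x * y * z + y * z * y * x - y * z * x * y +
        y * y * x * z - y * y * z * x) := by
  have h' : ∀ a b c : A, a * (b * c) = a * b * c + b * a * c := fun a b c => by
    rw [h, add_mul]
  let c : A → A → A := fun a b => a * b - b * a
  change c y (c (c y x) z + c x (c y z)) + c y (c (c z y) x + c y (c z x)) -
      c y (c (c x y) z + c y (c x z)) +
    (2 : ℕ) • ((c (c (c y z) y) x + c y (c (c y z) x)) - (c (c (c y x) y) z + c y (c (c y x) z))) =
    _
  simp only [c, mul_sub, sub_mul, mul_add, add_mul, h']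
  abel

/-- The element `4 (yxzy - yxyz + yzyx - yzxy + yyxz - yyzx)` of `ST({x, y, z})`. -/
noncomputable def exceptionalElement (K : Type*) [Field K] : FreeSpecialTortkara K (Fin 3) :=
  let g : Fin 3 → FreeSpecialTortkara K (Fin 3) := fun x =>
    ⟨Minus.of (Zin.gen K x), NonUnitalAlgebra.subset_adjoin K ⟨x, rfl⟩⟩
  tortkaraWitness (g 0) (g 1) (g 2)

/-- The trace of `separator` on ST is an ideal containing the three generators, but not this
element. -/
theorem exceptionalElement_notMem (K : Type*) [Field K] [CharZero K] :
    exceptionalElement K ∉ (exceptionalIdeal K).toSubmodule := by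
  let ι : FreeSpecialTortkara K (Fin 3) →ₙₐ[K] Minus (Zin K (Fin 3)) :=
    NonUnitalSubalgebraClass.subtype _
  let I : AlgIdeal K (FreeSpecialTortkara K (Fin 3)) :=
    { (Zin.separator K).comap (ι : _ →ₗ[K] Minus (Zin K (Fin 3))) with
      mul_mem_left := fun a _ hb => Zin.comm_mem_separator (Minus.val (ι a)) hb
      mul_mem_right := by
        intro a b hb
        have h := neg_mem (Zin.comm_mem_separator (Minus.val (ι a)) hb)
        have h' : -Zin.comm (Minus.val (ι a)) (Minus.val (ι b)) = Minus.val (ι (b * a)) :=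
          neg_sub _ _
        change Minus.val (ι (b * a)) ∈ Zin.separator K
        exact h' ▸ h }
  have hI : (exceptionalIdeal K).toSubmodule ≤ I.toSubmodule := by
    refine Zin.span_le_of_subset ?_
    rintro _ (rfl | rfl | rfl) <;> exact Zin.skewRcom_mem_separator (by simp)
  intro h
  have h1 : Minus.val (ι (exceptionalElement K)) ∈ Zin.separator K := hI h
  rw [exceptionalElement, map_tortkaraWitness] at h1
  have h2 := (Zin.mem_separator.1 h1).1.2
  have h3 := tortkaraWitness_minus (Zin.isZinbiel K (Fin 3)) (Zin.gen K 0) (Zin.gen K 1)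
    (Zin.gen K 2)
  have h4 := (congrArg (Zin.separatingForm K) h3).symm.trans h2
  -- The form takes the value 4 · 3 = 12.
  simp [Zin.separatingForm, Zin.coeff₄, Zin.dropLast_mul, Zin.dropLast_gen, Zin.coeff_gen] at h4
  norm_num at h4

theorem not_isSpecial_exceptional (K : Type u) [Field K] [CharZero K] :
    ¬ IsSpecial.{w} K (exceptionalIdeal K).Quotient := by
  rintro ⟨A, _, _, _, _, hA, f, hf⟩
  let π : FreeSpecialTortkara K (Fin 3) →ₙₐ[K] (exceptionalIdeal K).Quotient :=
    { toFun := (exceptionalIdeal K).proj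
      map_smul' := fun c a => map_smul (exceptionalIdeal K).proj c a
      map_zero' := map_zero (exceptionalIdeal K).proj
      map_add' := map_add (exceptionalIdeal K).proj
      map_mul' := fun _ _ => rfl }
  let ψ := f.comp π
  have hψ : ∀ a, ψ a = 0 → a ∈ (exceptionalIdeal K).toSubmodule := by
    intro a ha
    have h1 : (exceptionalIdeal K).proj a = (exceptionalIdeal K).proj 0 :=
      hf (ha.trans (map_zero ψ).symm)
    simpa using (AlgIdeal.proj_eq_proj _).1 h1
  let g : Fin 3 → FreeSpecialTortkara K (Fin 3) := fun x =>
    ⟨Minus.of (Zin.gen K x), NonUnitalAlgebra.subset_adjoin K ⟨x, rfl⟩⟩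
  let t : Fin 3 → A := fun x => Minus.val (ψ (g x))
  have hskew : ∀ b c : Fin 3, FreeSpecialTortkara.skew K 1 b c ∈ (exceptionalIdeal K).toSubmodule →
      t 1 * t b * t c = t 1 * t c * t b := by
    intro b c h
    have h1 : (2 : ℕ) • FreeSpecialTortkara.skew K 1 b c = g 1 * g b * g c + g b * (g 1 * g c) :=
      Subtype.ext (skew_combination_minus (Zin.isZinbiel K (Fin 3)) _ _ _).symm
    have h2 : ψ (FreeSpecialTortkara.skew K 1 b c) = 0 := by
      have h3 : (exceptionalIdeal K).proj (FreeSpecialTortkara.skew K 1 b c) =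
          (exceptionalIdeal K).proj 0 := (AlgIdeal.proj_eq_proj _).2 (by simpa using h)
      exact (congrArg f h3).trans (map_zero ψ)
    have h3 : (2 : ℕ) • (t 1 * t b * t c - t 1 * t c * t b) = 0 := by
      rw [← skew_combination_minus hA]
      change ψ (g 1) * ψ (g b) * ψ (g c) + ψ (g b) * (ψ (g 1) * ψ (g c)) = 0
      rw [← map_mul, ← map_mul, ← map_mul, ← map_mul, ← map_add, ← h1, map_nsmul, h2, smul_zero]
    rw [← Nat.cast_smul_eq_nsmul K, smul_eq_zero] at h3
    exact sub_eq_zero.1 (h3.resolve_left (by norm_num))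
  refine exceptionalElement_notMem K (hψ _ ?_)
  have h1 := tortkaraWitness_minus hA (t 0) (t 1) (t 2)
  have m : ∀ b c, FreeSpecialTortkara.skew K 1 b c ∈ ({FreeSpecialTortkara.skew K 1 1 2,
      FreeSpecialTortkara.skew K 1 0 2, FreeSpecialTortkara.skew K 1 0 1} : Set _) →
      t 1 * t b * t c = t 1 * t c * t b := fun b c h => hskew b c (AlgIdeal.subset_span _ h)
  -- Replacing yyz by yzy, yxz by yzx and yxy by yyx makes the six words cancel in pairs.
  rw [m 1 2 (by simp), m 0 2 (by simp), m 0 1 (by simp)] at h1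
  rw [exceptionalElement, map_tortkaraWitness]
  refine h1.trans ?_
  abel

theorem isTortkara_exceptional (K : Type*) [Field K] [CharZero K] :
    IsTortkara (exceptionalIdeal K).Quotient :=
  (exceptionalIdeal K).isTortkara_quotient (FreeSpecialTortkara.isTortkara K _)

/-! ### Letter operators

`R a` plays the role of the multiplication by a last letter `a`, and `A a` that of the shuffle with
the letter `a`. -/

namespace LetterOperators

variable {K T : Type*} [Field K] [AddCommGroup T] [Module K T]

theorem mem_of_nsmul_mem [CharZero K] (N : Submodule K T) {n : ℕ} (hn : n ≠ 0) {v : T}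
    (h : n • v ∈ N) : v ∈ N := by
  rw [← Nat.cast_smul_eq_nsmul K] at h
  exact (Submodule.smul_mem_iff N (Nat.cast_ne_zero.2 hn)).1 h

/-! ### Words, and commutation of letters modulo a subspace. -/

section Words

variable {X : Type*} (R A : X → T →ₗ[K] T)

/-- Append a word to `f`. -/
def word (f : T) (t : List X) : T := t.foldl (fun g a => R a g) f

theorem word_nil (f : T) : word R f [] = f := rfl

theorem word_cons (f : T) (a : X) (t : List X) : word R f (a :: t) = word R (R a f) t := rfl

theorem word_append (f : T) (s t : List X) : word R f (s ++ t) = word R (word R f s) t :=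
  List.foldl_append

theorem word_concat (f : T) (t : List X) (a : X) : word R f (t ++ [a]) = R a (word R f t) :=
  word_append R f t [a]

theorem word_add (f g : T) (t : List X) : word R (f + g) t = word R f t + word R g t := by
  induction t generalizing f g with
  | nil => rfl
  | cons a t ih => rw [word_cons, map_add, ih]; rfl

theorem word_smul (c : K) (f : T) (t : List X) : word R (c • f) t = c • word R f t := by
  induction t generalizing f with
  | nil => rfl
  | cons a t ih => rw [word_cons, map_smul, ih]; rfl

theorem word_neg (f : T) (t : List X) : word R (-f) t = -word R f t := by
  rw [← neg_one_smul K, word_smul, neg_one_smul]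

theorem word_sub (f g : T) (t : List X) : word R (f - g) t = word R f t - word R g t := by
  rw [sub_eq_add_neg, word_add, word_neg, sub_eq_add_neg]

/-- Modulo `N`, neighbouring letters of every word `f u` commute, for `u` of length `n`. -/
def CommutesMod (N : Submodule K T) (f : T) (n : ℕ) : Prop :=
  ∀ (p s : List X) (b c : X), p.length + s.length + 2 = n →
    word R f (p ++ b :: c :: s) - word R f (p ++ c :: b :: s) ∈ N

variable {R A}

/-- Fixing the last letter leaves commutation of the earlier ones; this feeds inductions from the
end of a word. -/
theorem CommutesMod.comap {N : Submodule K T} {f : T} {n : ℕ} (h : CommutesMod R N f (n + 1))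
    (a : X) : CommutesMod R (N.comap (R a)) f n := by
  intro p s b c hl
  have := h p (s ++ [a]) b c (by simp; omega)
  simpa only [Submodule.mem_comap, map_sub, ← word_concat, List.append_assoc, List.cons_append]
    using this

theorem CommutesMod.rotate {N : Submodule K T} {f : T} (t : List X) (a : X)
    (h : CommutesMod R N f (t.length + 1)) : word R f (a :: t) - R a (word R f t) ∈ N := by
  induction t using List.reverseRecOn generalizing N with
  | nil => simp [word]
  | append_singleton t b ih =>
    rw [List.length_append, List.length_singleton] at h
    have h1 := ih (h.comap b)
    have h2 := h t [] a b (by simp)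
    rw [Submodule.mem_comap, map_sub, ← word_concat] at h1
    have h3 : t ++ [a, b] = t ++ [a] ++ [b] := by simp
    have h4 : t ++ [b, a] = t ++ [b] ++ [a] := by simp
    rw [h3, h4, word_concat, word_concat, word_concat, word_concat] at h2
    rw [word_concat, ← List.cons_append, word_concat]
    rw [word_concat] at h1
    simpa using add_mem h1 h2

/-- The letter a is shuffled into f, or inserted after one of the letters of t; modulo N each of
these |t| insertions equals f t a. -/
theorem CommutesMod.shuffle {N : Submodule K T} {f : T} (t : List X) (a : X)
    (hRA : ∀ a b g, A a (R b g) = R b (A a g) + R a (R b g))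
    (h : CommutesMod R N f (t.length + 1)) :
    A a (word R f t) - (word R (A a f) t + t.length • R a (word R f t)) ∈ N := by
  induction t using List.reverseRecOn generalizing N with
  | nil => simp [word]
  | append_singleton t b ih =>
    rw [List.length_append, List.length_singleton] at h
    have h1 := ih (h.comap b)
    have h2 := h t [] a b (by simp)
    have h3 : t ++ [a, b] = t ++ [a] ++ [b] := by simp
    have h4 : t ++ [b, a] = t ++ [b] ++ [a] := by simp
    rw [h3, h4, word_concat, word_concat, word_concat, word_concat] at h2
    rw [Submodule.mem_comap, map_sub, map_add, map_nsmul] at h1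
    rw [word_concat, word_concat, hRA, List.length_append, List.length_singleton]
    convert add_mem h1 (N.smul_of_tower_mem t.length h2) using 1
    rw [add_smul, one_smul, smul_sub]
    abel

variable (R) in
/-- The span of the words of length `n` on a given element. -/
def wordSpan (one : T) (n : ℕ) : Submodule K T :=
  Submodule.span K {v | ∃ t : List X, t.length = n ∧ v = word R one t}

theorem word_mem_wordSpan (one : T) (t : List X) : word R one t ∈ wordSpan R one t.length :=
  Submodule.subset_span ⟨t, rfl, rfl⟩

theorem one_mem_wordSpan (one : T) : one ∈ wordSpan R one 0 :=
  Submodule.subset_span ⟨[], rfl, rfl⟩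

theorem map_mem_wordSpan {one g : T} {n : ℕ} (a : X) (hg : g ∈ wordSpan R one n) :
    R a g ∈ wordSpan R one (n + 1) := by
  have h : wordSpan R one n ≤ (wordSpan R one (n + 1)).comap (R a) := by
    refine Submodule.span_le.2 ?_
    rintro _ ⟨t, rfl, rfl⟩
    exact Submodule.subset_span ⟨t ++ [a], by simp, (word_concat R _ _ _).symm⟩
  exact h hg

theorem word_mem_wordSpan_of_mem {one g : T} {n : ℕ} (hg : g ∈ wordSpan R one n) (t : List X) :
    word R g t ∈ wordSpan R one (n + t.length) := by
  induction t generalizing g n with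
  | nil => exact hg
  | cons a t ih =>
    rw [word_cons, List.length_cons, add_comm t.length, ← add_assoc]
    exact ih (map_mem_wordSpan a hg)

theorem shuffle_mem_wordSpan {one g : T} {n : ℕ} (a : X)
    (hRA : ∀ a b g, A a (R b g) = R b (A a g) + R a (R b g)) (h1 : A a one = R a one)
    (hg : g ∈ wordSpan R one n) : A a g ∈ wordSpan R one (n + 1) := by
  have h : wordSpan R one n ≤ (wordSpan R one (n + 1)).comap (A a) := by
    refine Submodule.span_le.2 ?_
    rintro _ ⟨t, rfl, rfl⟩
    change A a (word R one t) ∈ wordSpan R one (t.length + 1)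
    clear hg
    induction t using List.reverseRecOn with
    | nil => rw [word_nil, h1]; exact word_mem_wordSpan one [a]
    | append_singleton t b ih =>
      rw [word_concat, hRA, List.length_append, List.length_singleton]
      exact add_mem (map_mem_wordSpan b ih)
        (map_mem_wordSpan a (map_mem_wordSpan b (word_mem_wordSpan one t)))
  exact h hg

end Words

/-! ### Two letters: appending w = xy − yx. -/

section TwoLetters

variable {R A : Fin 2 → T →ₗ[K] T}

variable (R) in
/-- Append `xy - yx`. -/
def appendSkew : T →ₗ[K] T := R 1 ∘ₗ R 0 - R 0 ∘ₗ R 1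

theorem appendSkew_apply (g : T) : appendSkew R g = R 1 (R 0 g) - R 0 (R 1 g) := rfl

theorem commutesMod_of_appendSkew {N : Submodule K T} {f : T} {n : ℕ}
    (h : ∀ p s : List (Fin 2), p.length + s.length + 2 = n →
      word R (appendSkew R (word R f p)) s ∈ N) : CommutesMod R N f n := by
  intro p s b c hl
  have h1 := h p s hl
  rw [appendSkew_apply, word_sub] at h1
  have h2 := neg_mem h1
  rw [neg_sub] at h2
  rw [word_append, word_append, word_cons, word_cons, word_cons, word_cons]
  fin_cases b <;> fin_cases c
  · simp
  · exact h1
  · exact h2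
  · simp

/-- Inserting a between the letters of w gives xay − yax, which is a w + w a because a is x or y.
Consequently the commutator of a with g w is (a ш g + g a) w. -/
theorem shuffle_appendSkew (hRA : ∀ a b g, A a (R b g) = R b (A a g) + R a (R b g)) (a : Fin 2)
    (g : T) :
    A a (appendSkew R g) = appendSkew R (A a g + R a g) + (2 : ℕ) • R a (appendSkew R g) := by
  fin_cases a <;> simp only [appendSkew_apply, map_sub, map_add, hRA, two_nsmul, Fin.zero_eta,
    Fin.mk_one] <;> abel

variable [CharZero K]

/-- The operators A a − 2 R a are commutators with letters, and [y, [x, f]] − [x, [y, f]] = 2 f w.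
-/
theorem appendSkew_mem (hRA : ∀ a b g, A a (R b g) = R b (A a g) + R a (R b g))
    (hA : ∀ g, A 0 (A 1 g) = A 1 (A 0 g)) {I : Submodule K T}
    (hI : ∀ a, ∀ f ∈ I, A a f - (2 : ℕ) • R a f ∈ I) {f : T} (hf : f ∈ I) :
    appendSkew R f ∈ I := by
  refine mem_of_nsmul_mem I two_ne_zero ?_
  convert sub_mem (hI 1 _ (hI 0 f hf)) (hI 0 _ (hI 1 f hf)) using 1
  simp only [appendSkew_apply, map_sub, two_nsmul, map_add, hRA, hA]
  abel

/-- A subspace stable under the operators `A a - 2 R a` (the commutators with letters) contains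
`f t (xy - yx)` for all its elements `f` and all words `t`. -/
theorem appendSkew_word_mem (hRA : ∀ a b g, A a (R b g) = R b (A a g) + R a (R b g))
    (hA : ∀ g, A 0 (A 1 g) = A 1 (A 0 g)) {I : Submodule K T}
    (hI : ∀ a, ∀ f ∈ I, A a f - (2 : ℕ) • R a f ∈ I) (n : ℕ) :
    ∀ f ∈ I, ∀ t : List (Fin 2), t.length = n → appendSkew R (word R f t) ∈ I := by
  induction n using Nat.strong_induction_on with
  | _ n ih =>
    intro f hf t ht
    induction t using List.reverseRecOn with
    | nil => exact appendSkew_mem hRA hA hI hf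
    | append_singleton t a _ =>
      rw [List.length_append, List.length_singleton] at ht
      -- S consists of the g with g w ∈ I; by the shorter cases, the letters after f commute modulo
      -- S.
      set S := I.comap (appendSkew R) with hS
      have hc : CommutesMod R S f (t.length + 1) := by
        refine commutesMod_of_appendSkew fun p s hps => ?_
        exact ih s.length (by omega) _ (ih p.length (by omega) f hf p rfl) s rfl
      have h1 := hc.shuffle t a hRA
      have h2 := hc.rotate t a
      have h3 : A a (word R f t) + R a (word R f t) ∈ S := by
        have h := hI a _ (ih t.length (by omega) f hf t rfl)
        rwa [shuffle_appendSkew hRA, add_sub_cancel_right] at h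
      have h4 : word R (A a f - (2 : ℕ) • R a f) t ∈ S :=
        ih t.length (by omega) _ (hI a f hf) t rfl
      rw [word_sub, two_nsmul, word_add] at h4
      rw [word_cons] at h2
      -- Modulo S: −f t a ≡ A a (f t) ≡ (A a f) t + |t| f t a, and (A a f) t ≡ 2 f a t ≡ 2 f t a.
      have h5 : (t.length + 3) • R a (word R f t) ∈ S := by
        convert sub_mem (sub_mem (sub_mem h3 h1) h4) (S.smul_of_tower_mem 2 h2) using 1
        rw [add_smul, smul_sub, two_nsmul, two_nsmul, succ_nsmul, two_nsmul]
        abel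
      rw [word_concat]
      exact mem_of_nsmul_mem S (by omega) h5

/-- A subspace which contains all `u (xy - yx)` for words `u` of length `k`, and the shuffles of
all letters with all words of length `k + 1`, contains all words of length `k + 2`. -/
theorem wordSpan_le (hRA : ∀ a b g, A a (R b g) = R b (A a g) + R a (R b g)) {one : T}
    (hone : ∀ a, A a one = R a one) {N : Submodule K T} {k : ℕ}
    (hW : ∀ g ∈ wordSpan R one k, appendSkew R g ∈ N)
    (hN : ∀ a, ∀ g ∈ wordSpan R one (k + 1), A a g ∈ N) : wordSpan R one (k + 2) ≤ N := by
  have hskew : ∀ {j : ℕ} {g : T}, g ∈ wordSpan R one j →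
      appendSkew R g ∈ wordSpan R one (j + 2) := fun hg =>
    sub_mem (map_mem_wordSpan 1 (map_mem_wordSpan 0 hg))
      (map_mem_wordSpan 0 (map_mem_wordSpan 1 hg))
  have key : ∀ m j : ℕ, j + m = k → ∀ g ∈ wordSpan R one j, ∀ t : List (Fin 2), t.length = m →
      word R (appendSkew R g) t ∈ N := by
    intro m
    induction m using Nat.strong_induction_on with
    | _ m ih =>
      intro j hj g hg t ht
      induction t using List.reverseRecOn with
      | nil =>
        obtain rfl : j = k := by simp at ht; omega
        exact hW g hg
      | append_singleton t a _ =>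
        rw [List.length_append, List.length_singleton] at ht
        have hc : CommutesMod R N (appendSkew R g) (t.length + 1) := by
          refine commutesMod_of_appendSkew fun p s hps => ?_
          exact ih s.length (by omega) (j + 2 + p.length) (by omega) _
            (word_mem_wordSpan_of_mem (hskew hg) p) s rfl
        have h1 := hc.shuffle t a hRA
        have h2 := hc.rotate t a
        have h3 : A a (word R (appendSkew R g) t) ∈ N := by
          refine hN a _ ?_
          have h := word_mem_wordSpan_of_mem (hskew hg) t
          rwa [show j + 2 + t.length = k + 1 by omega] at h
        have h4 : word R (appendSkew R (A a g + R a g)) t ∈ N :=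
          ih t.length (by omega) (j + 1) (by omega) _
            (add_mem (shuffle_mem_wordSpan a hRA (hone a) hg) (map_mem_wordSpan a hg)) t rfl
        rw [shuffle_appendSkew hRA, two_nsmul, word_add, word_add] at h1
        rw [word_cons] at h2
        -- Modulo N: 0 ≡ A a (g w t) ≡ (A a g + g a) w t + 2 g w a t + |t| g w t a, whose first term
        -- is a shorter case.
        have h5 : (t.length + 2) • R a (word R (appendSkew R g) t) ∈ N := by
          convert sub_mem (sub_mem (sub_mem h3 h1) h4) (N.smul_of_tower_mem 2 h2) using 1
          rw [add_smul, smul_sub, two_nsmul, two_nsmul]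
          abel
        rw [word_concat]
        exact mem_of_nsmul_mem N (by omega) h5
  refine Submodule.span_le.2 ?_
  rintro _ ⟨t, ht, rfl⟩
  induction t using List.reverseRecOn with
  | nil => simp at ht
  | append_singleton t a _ =>
    rw [List.length_append, List.length_singleton] at ht
    have hc : CommutesMod R N one (t.length + 1) := by
      refine commutesMod_of_appendSkew fun p s hps => ?_
      exact key s.length p.length (by omega) _ (word_mem_wordSpan one p) s rfl
    have h1 := hc.shuffle t a hRA
    have h2 := hc.rotate t a
    have h3 : A a (word R one t) ∈ N := by
      refine hN a _ ?_
      have h := word_mem_wordSpan (R := R) one t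
      rwa [show t.length = k + 1 by omega] at h
    rw [hone] at h1
    rw [word_cons] at h2
    -- All letters commute modulo N by `key`, so 0 ≡ A a t ≡ (|t| + 1) t a.
    have h5 : (t.length + 1) • R a (word R one t) ∈ N := by
      convert sub_mem (sub_mem h3 h1) h2 using 1
      rw [add_smul, one_smul]
      abel
    rw [word_concat]
    exact mem_of_nsmul_mem N (by omega) h5

end TwoLetters

end LetterOperators

/-! ### The letter operators on the unitization of Zin(X). -/

namespace Zin

variable {K : Type*} {X : Type*} [Field K]

/-- Append the letter `a` in the unitization of `Zin(X)`. -/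
noncomputable def append (a : X) : K × Zin K X →ₗ[K] K × Zin K X :=
  LinearMap.inr K K (Zin K X) ∘ₗ
    (LinearMap.toSpanSingleton K _ (gen K a)).coprod (LinearMap.mulRight K (gen K a))

theorem append_apply (a : X) (g : K × Zin K X) :
    append a g = (0, g.1 • gen K a + g.2 * gen K a) := rfl

/-- The shuffle with the letter `a` in the unitization of `Zin(X)`. -/
noncomputable def shuffleLetter (a : X) : K × Zin K X →ₗ[K] K × Zin K X :=
  LinearMap.inr K K (Zin K X) ∘ₗ (LinearMap.toSpanSingleton K _ (gen K a)).coprod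
    (LinearMap.mulLeft K (gen K a) + LinearMap.mulRight K (gen K a))

theorem shuffleLetter_apply (a : X) (g : K × Zin K X) :
    shuffleLetter a g = (0, g.1 • gen K a + (gen K a * g.2 + g.2 * gen K a)) := rfl

theorem shuffleLetter_append (a b : X) (g : K × Zin K X) :
    shuffleLetter a (append b g) = append b (shuffleLetter a g) + append a (append b g) := by
  simp only [shuffleLetter_apply, append_apply, zero_smul, zero_add, mul_add, add_mul,
    mul_smul_comm, smul_mul_assoc, isZinbiel K X (gen K a) g.2, Prod.mk_add_mk, add_zero]

theorem shuffleLetter_comm (a b : X) (g : K × Zin K X) :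
    shuffleLetter a (shuffleLetter b g) = shuffleLetter b (shuffleLetter a g) := by
  have h' : ∀ a b c : Zin K X, a * (b * c) = a * b * c + b * a * c := fun a b c => by
    rw [isZinbiel K X, add_mul]
  simp only [shuffleLetter_apply, zero_smul, zero_add, mul_add, add_mul, mul_smul_comm,
    smul_mul_assoc, h']
  congr 1
  abel

theorem shuffleLetter_one (a : X) :
    shuffleLetter a ((1, 0) : K × Zin K X) = append a ((1, 0) : K × Zin K X) := by
  simp [shuffleLetter_apply, append_apply]

theorem inr_mul_gen (u : Zin K X) (a : X) :
    ((0, u * gen K a) : K × Zin K X) = append a (0, u) := by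
  simp [append_apply]

theorem inr_comm_gen (u : Zin K X) (a : X) :
    ((0, gen K a * u - u * gen K a) : K × Zin K X) =
      shuffleLetter a (0, u) - (2 : ℕ) • append a (0, u) := by
  rw [shuffleLetter_apply, append_apply, two_nsmul, Prod.mk_add_mk, Prod.mk_sub_mk]
  simp only [zero_smul, zero_add, sub_self]
  congr 1
  abel

theorem append_mem_wordSpan_induction {N : Submodule K (K × Zin K X)}
    (h : ∀ n, LetterOperators.wordSpan append ((1, 0) : K × Zin K X) n ≤ N) (g : K × Zin K X) :
    g ∈ N := by
  have h0 : ((1, 0) : K × Zin K X) ∈ N := h 0 (LetterOperators.one_mem_wordSpan _)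
  have hmem : ∀ n u, u ∈ LetterOperators.wordSpan append ((1, 0) : K × Zin K X) n →
      u ∈ ⨆ n, LetterOperators.wordSpan append ((1, 0) : K × Zin K X) n := fun n _ hu =>
    le_iSup (LetterOperators.wordSpan append ((1, 0) : K × Zin K X)) n hu
  have hle : ⨆ n, LetterOperators.wordSpan append ((1, 0) : K × Zin K X) n ≤ N := iSup_le h
  generalize hU : ⨆ n, LetterOperators.wordSpan append ((1, 0) : K × Zin K X) n = U at hmem hle
  have hR : ∀ a, ∀ u ∈ U, append a u ∈ U := by
    intro a u hu
    have h2 : U ≤ U.comap (append a) := by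
      conv_lhs => rw [← hU]
      refine iSup_le fun n u hu => ?_
      rw [Submodule.mem_comap]
      exact hmem (n + 1) _ (LetterOperators.map_mem_wordSpan a hu)
    exact h2 hu
  have h1 : ∀ z : Zin K X, ((0, z) : K × Zin K X) ∈ U := by
    refine fun z => mem_of_mul_gen_mem (U := U.comap (LinearMap.inr K K (Zin K X))) ?_ ?_ z
    · intro x
      have h2 : ((0, gen K x) : K × Zin K X) = append x (1, 0) := by simp [append_apply]
      change ((0, gen K x) : K × Zin K X) ∈ U
      rw [h2]
      exact hR x _ (hmem 0 _ (LetterOperators.one_mem_wordSpan _))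
    · intro u hu x
      change ((0, u * gen K x) : K × Zin K X) ∈ U
      rw [inr_mul_gen]
      exact hR x _ hu
  have h3 : g = g.1 • (1, 0) + (0, g.2) := by simp
  rw [h3]
  exact add_mem (N.smul_mem _ h0) (hle (h1 g.2))

/-- The shuffle product of the unitization. -/
noncomputable def shuffleOne (s t : K × Zin K X) : K × Zin K X :=
  (s.1 * t.1, s.1 • t.2 + (t.1 • s.2 + (s.2 * t.2 + t.2 * s.2)))

theorem shuffleOne_comm (s t : K × Zin K X) : shuffleOne s t = shuffleOne t s := by
  refine Prod.ext (mul_comm _ _) ?_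
  simp only [shuffleOne]
  abel

theorem shuffleOne_add (s t r : K × Zin K X) :
    shuffleOne s (t + r) = shuffleOne s t + shuffleOne s r := by
  refine Prod.ext (mul_add _ _ _) ?_
  simp only [shuffleOne, Prod.fst_add, Prod.snd_add, smul_add, add_smul, mul_add, add_mul]
  abel

theorem shuffleOne_zero (s : K × Zin K X) : shuffleOne s 0 = 0 := by
  simp [shuffleOne]

section Derivative

variable [Fintype X] [DecidableEq X]

/-- The letter derivative on the unitization. -/
noncomputable def derivOne (a : X) : K × Zin K X →ₗ[K] K × Zin K X :=
  deriv a ∘ₗ LinearMap.snd K K _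

theorem derivOne_append (a b : X) (g : K × Zin K X) :
    derivOne a (append b g) = if a = b then g else 0 := by
  change deriv a (g.1 • gen K b + g.2 * gen K b) = _
  rw [map_add, map_smul, deriv_gen, deriv_mul, deriv_gen]
  split_ifs <;> simp [shuffle]

theorem derivOne_one (a : X) : derivOne a ((1, 0) : K × Zin K X) = 0 :=
  map_zero (deriv a)

theorem eq_sum_append (u : Zin K X) :
    ((0, u) : K × Zin K X) = ∑ a, append a (derivOne a (0, u)) := by
  have h : ∀ s : Finset X, ∑ a ∈ s, append a (derivOne a (0, u)) =
      ((0, ∑ a ∈ s, ((deriv a u).1 • gen K a + (deriv a u).2 * gen K a)) : K × Zin K X) := by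
    intro s
    induction s using Finset.cons_induction with
    | empty => rfl
    | cons a s ha ih =>
      rw [Finset.sum_cons, Finset.sum_cons, ih, append_apply, Prod.mk_add_mk, add_zero]
      rfl
  rw [h, ← eq_sum_deriv]

/-! ### Special Tortkara elements -/

/-- The elements of `Zin(X)` which are skew-symmetric in the last two letters. -/
noncomputable def skewElements (K X : Type*) [Field K] [Fintype X] [DecidableEq X] :
    Submodule K (Zin K X) :=
  ⨅ (a : X) (b : X), LinearMap.ker (derivOne b ∘ₗ deriv a + derivOne a ∘ₗ deriv b)

theorem mem_skewElements {u : Zin K X} : u ∈ skewElements K X ↔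
    ∀ a b, derivOne b (deriv a u) + derivOne a (deriv b u) = 0 := by
  simp [skewElements]

theorem derivOne_deriv_mul (a b : X) (u v : Zin K X) :
    derivOne b (deriv a (u * v)) =
      shuffleOne (0, u) (derivOne b (deriv a v)) + shuffleOne (deriv a v) (deriv b u) := by
  rw [deriv_mul]
  change deriv b (shuffle u (deriv a v)) = _
  rw [shuffle, map_add, map_add, map_smul, deriv_mul, deriv_mul]
  change _ = shuffleOne (0, u) (deriv b (deriv a v).2) + _
  refine Prod.ext ?_ ?_
  · simp [shuffleOne]
  · simp only [shuffleOne, shuffle, Prod.snd_add, Prod.smul_snd, zero_smul, zero_add]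
    abel

/-- After symmetrizing in a and b, the cross terms ∂ₐv ш ∂_b u of the second derivatives are
symmetric in u and v, so they cancel in the commutator. -/
theorem commutator_mem_skewElements {u v : Zin K X} (hu : u ∈ skewElements K X)
    (hv : v ∈ skewElements K X) : u * v - v * u ∈ skewElements K X := by
  rw [mem_skewElements] at *
  intro a b
  have h1 : shuffleOne (0, u) (derivOne b (deriv a v)) +
      shuffleOne (0, u) (derivOne a (deriv b v)) = 0 := by
    rw [← shuffleOne_add, hv, shuffleOne_zero]
  have h2 : shuffleOne (0, v) (derivOne b (deriv a u)) +
      shuffleOne (0, v) (derivOne a (deriv b u)) = 0 := by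
    rw [← shuffleOne_add, hu, shuffleOne_zero]
  simp only [map_sub, derivOne_deriv_mul]
  rw [shuffleOne_comm (deriv a u), shuffleOne_comm (deriv b u)]
  rw [← sub_zero (0 : K × Zin K X)]
  nth_rewrite 2 [← h2]
  rw [← h1]
  abel

theorem freeSpecialTortkara_subset {u : Minus (Zin K X)} (hu : u ∈ FreeSpecialTortkara K X) :
    Minus.val u ∈ skewElements K X := by
  let S : NonUnitalSubalgebra K (Minus (Zin K X)) :=
    { (skewElements K X : Submodule K (Zin K X)) with
      mul_mem' := fun ha hb => commutator_mem_skewElements ha hb }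
  have h : FreeSpecialTortkara K X ≤ S := by
    refine NonUnitalAlgebra.adjoin_le ?_
    rintro _ ⟨x, rfl⟩
    refine mem_skewElements.2 fun a b => ?_
    change derivOne b (deriv a (gen K x)) + derivOne a (deriv b (gen K x)) = 0
    rw [deriv_gen, deriv_gen]
    split_ifs <;> simp [derivOne_one]
  exact h hu

/-- Every element of `ST({x, y})` has the form `αx + βy + v(xy - yx)`. -/
theorem exists_of_mem_skewElements [CharZero K] {u : Zin K (Fin 2)}
    (hu : u ∈ skewElements K (Fin 2)) :
    ∃ (α β : K) (v : K × Zin K (Fin 2)), ((0, u) : K × Zin K (Fin 2)) =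
      α • append 0 (1, 0) + β • append 1 (1, 0) + LetterOperators.appendSkew append v := by
  rw [mem_skewElements] at hu
  have h0 : ∀ f : K × Zin K (Fin 2), f + f = 0 → f = 0 := by
    intro f hf
    rw [← two_smul K, smul_eq_zero] at hf
    exact hf.resolve_left two_ne_zero
  have h1 : ∀ f : K × Zin K (Fin 2),
      f = f.1 • (1, 0) + (append 0 (derivOne 0 f) + append 1 (derivOne 1 f)) := by
    intro f
    have h := eq_sum_append f.2
    rw [Fin.sum_univ_two] at h
    calc f = f.1 • (1, 0) + (0, f.2) := by simp
      _ = _ := by rw [h]; rfl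
  have h2 := h1 (deriv 0 u)
  have h3 := h1 (deriv 1 u)
  -- For a = b skewness reads 2 ∂ₐ∂ₐu = 0: no word of u ends in xx or yy.
  rw [h0 _ (hu 0 0), map_zero, zero_add] at h2
  rw [h0 _ (hu 1 1), map_zero, add_zero] at h3
  have h4 := eq_neg_of_add_eq_zero_left (hu 0 1)
  have h5 := eq_sum_append u
  rw [Fin.sum_univ_two] at h5
  change _ = append 0 (deriv 0 u) + append 1 (deriv 1 u) at h5
  refine ⟨(deriv 0 u).1, (deriv 1 u).1, derivOne 0 (deriv 1 u), ?_⟩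
  rw [h5, LetterOperators.appendSkew_apply]
  nth_rewrite 1 [h2]
  nth_rewrite 1 [h3]
  rw [h4]
  simp only [map_add, map_smul, map_neg]
  abel

end Derivative

end Zin

/-! ### The right-stable hull of I. -/

namespace LetterOperators

variable {K T : Type*} [Field K] [AddCommGroup T] [Module K T]

section Closure

variable (R : Fin 2 → T →ₗ[K] T) (I : Submodule K T)

/-- The sums of elements of `I` followed by words of length less than `m`. -/
def closureStep : ℕ → Submodule K T
  | 0 => ⊥
  | m + 1 => I ⊔ ((closureStep m).map (R 0) ⊔ (closureStep m).map (R 1))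

/-- The smallest subspace containing `I` and stable under the operators `R a`. -/
def closure : Submodule K T := ⨆ m, closureStep R I m

variable {R I}

theorem mem_closureStep_succ {m : ℕ} {u : T} : u ∈ closureStep R I (m + 1) ↔
    ∃ i ∈ I, ∃ k ∈ closureStep R I m, ∃ l ∈ closureStep R I m, u = i + (R 0 k + R 1 l) := by
  rw [closureStep]
  constructor
  · intro h
    obtain ⟨i, hi, j, hj, rfl⟩ := Submodule.mem_sup.1 h
    obtain ⟨_, ⟨k, hk, rfl⟩, _, ⟨l, hl, rfl⟩, rfl⟩ := Submodule.mem_sup.1 hj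
    exact ⟨i, hi, k, hk, l, hl, rfl⟩
  · rintro ⟨i, hi, k, hk, l, hl, rfl⟩
    exact Submodule.add_mem_sup hi (Submodule.add_mem_sup (Submodule.mem_map_of_mem hk)
      (Submodule.mem_map_of_mem hl))

theorem closureStep_mono : Monotone (closureStep R I) := by
  refine monotone_nat_of_le_succ fun m => ?_
  induction m with
  | zero => exact bot_le
  | succ m ih =>
    exact sup_le_sup le_rfl (sup_le_sup (Submodule.map_mono ih) (Submodule.map_mono ih))

theorem mem_closure {u : T} : u ∈ closure R I ↔ ∃ m, u ∈ closureStep R I m :=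
  Submodule.mem_iSup_of_directed _ closureStep_mono.directed_le

theorem closureStep_le_closure (m : ℕ) : closureStep R I m ≤ closure R I := le_iSup _ m

theorem le_closure : I ≤ closure R I := fun i hi => by
  refine mem_closure.2 ⟨1, mem_closureStep_succ.2 ⟨i, hi, 0, zero_mem _, 0, zero_mem _, ?_⟩⟩
  simp

theorem map_mem_closure (a : Fin 2) {u : T} (hu : u ∈ closure R I) : R a u ∈ closure R I := by
  obtain ⟨m, hm⟩ := mem_closure.1 hu
  refine mem_closure.2 ⟨m + 1, mem_closureStep_succ.2 ?_⟩
  fin_cases a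
  · exact ⟨0, zero_mem _, u, hm, 0, zero_mem _, by simp⟩
  · exact ⟨0, zero_mem _, 0, zero_mem _, u, hm, by simp⟩

theorem closure_le {N : Submodule K T} (hI : I ≤ N) (hN : ∀ a, ∀ u ∈ N, R a u ∈ N) :
    closure R I ≤ N := by
  refine iSup_le fun m => ?_
  induction m with
  | zero => exact bot_le
  | succ m ih =>
    refine sup_le hI (sup_le ?_ ?_) <;> rw [Submodule.map_le_iff_le_comap]
    · exact fun u hu => hN 0 u (ih hu)
    · exact fun u hu => hN 1 u (ih hu)

theorem closure_le_span_word :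
    closure R I ≤ Submodule.span K {v | ∃ f ∈ I, ∃ t : List (Fin 2), v = word R f t} := by
  refine closure_le (fun f hf => Submodule.subset_span ⟨f, hf, [], rfl⟩) fun a u hu => ?_
  have h : Submodule.span K {v | ∃ f ∈ I, ∃ t : List (Fin 2), v = word R f t} ≤
      (Submodule.span K {v | ∃ f ∈ I, ∃ t : List (Fin 2), v = word R f t}).comap (R a) := by
    refine Submodule.span_le.2 ?_
    rintro _ ⟨f, hf, t, rfl⟩
    exact Submodule.subset_span ⟨f, hf, t ++ [a], (word_concat R _ _ _).symm⟩
  exact h hu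

theorem appendSkew_mem_of_mem_closure [CharZero K] {A : Fin 2 → T →ₗ[K] T}
    (hRA : ∀ a b g, A a (R b g) = R b (A a g) + R a (R b g))
    (hA : ∀ g, A 0 (A 1 g) = A 1 (A 0 g))
    (hI : ∀ a, ∀ f ∈ I, A a f - (2 : ℕ) • R a f ∈ I) {u : T} (hu : u ∈ closure R I) :
    appendSkew R u ∈ I := by
  have h : Submodule.span K {v | ∃ f ∈ I, ∃ t : List (Fin 2), v = word R f t} ≤
      I.comap (appendSkew R) := by
    refine Submodule.span_le.2 ?_
    rintro _ ⟨f, hf, t, rfl⟩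
    exact appendSkew_word_mem hRA hA hI _ f hf t rfl
  exact h (closure_le_span_word hu)

end Closure

/-! ### Separating the powers of y. -/

section Powers

variable {R A : Fin 2 → T →ₗ[K] T} {one : T}

variable (R one) in
/-- The powers of the letter `y`. -/
def power : ℕ → T
  | 0 => one
  | k + 1 => R 1 (power k)

theorem linearCombination_power_succ (c : ℕ →₀ K) :
    Finsupp.linearCombination K (power R one ∘ Nat.succ) c =
      R 1 (Finsupp.linearCombination K (power R one) c) := by
  rw [Finsupp.apply_linearCombination]
  rfl

theorem shuffle_power (hRA : ∀ a b g, A a (R b g) = R b (A a g) + R a (R b g))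
    (hone : ∀ a, A a one = R a one) (k : ℕ) :
    A 1 (power R one k) = ((k : K) + 1) • power R one (k + 1) := by
  induction k with
  | zero => simp [power, hone]
  | succ k ih =>
    rw [power, hRA, ih, map_smul]
    push_cast
    rw [add_smul ((k : K) + 1), one_smul]
    rfl

variable [CharZero K]

/-- Since A 1 acts on yᵏ as (k + 1) R 1, the operator A 1 − (s + n + 1) R 1 kills the top term and
leaves a shorter sum in J. -/
theorem smul_power_mem_of_sum_mem (hRA : ∀ a b g, A a (R b g) = R b (A a g) + R a (R b g))
    (hone : ∀ a, A a one = R a one) {J : Submodule K T} (hJR : ∀ u ∈ J, R 1 u ∈ J)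
    (hJA : ∀ u ∈ J, A 1 u ∈ J) (n : ℕ) : ∀ (c : ℕ → K) (s : ℕ),
    ∑ i ∈ Finset.range n, c i • power R one (s + i) ∈ J →
      ∀ i < n, c i • power R one (s + i) ∈ J := by
  induction n with
  | zero => intro _ _ _ i hi; omega
  | succ n ih =>
    intro c s h
    have h0 : c 0 • power R one s ∈ J := by
      rcases eq_or_ne (c 0) 0 with hc | hc
      · rw [hc, zero_smul]; exact zero_mem _
      have h1 : ∑ i ∈ Finset.range n, (c i * ((i : K) - n)) • power R one (s + 1 + i) ∈ J := by
        convert sub_mem (hJA _ h) (J.smul_mem ((s : K) + n + 1) (hJR _ h)) using 1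
        rw [map_sum, map_sum, Finset.smul_sum, ← Finset.sum_sub_distrib, Finset.sum_range_succ]
        have h2 : ∀ i, A 1 (c i • power R one (s + i)) -
            ((s : K) + n + 1) • R 1 (c i • power R one (s + i)) =
              (c i * ((i : K) - n)) • power R one (s + 1 + i) := by
          intro i
          rw [map_smul, map_smul, shuffle_power hRA hone]
          change _ - _ • c i • power R one (s + i + 1) = _
          rw [smul_smul, smul_smul, ← sub_smul, show s + i + 1 = s + 1 + i by omega]
          congr 1
          push_cast
          ring
        rw [Finset.sum_congr rfl fun i _ => h2 i, h2 n, sub_self, mul_zero, zero_smul, add_zero]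
      -- As c 0 ≠ 0, the shorter sum puts the power s + 1, hence all later ones, in J; only the term
      -- c 0 remains.
      have h2 : ∀ i, i < n → power R one (s + 1 + i) ∈ J := by
        intro i hi
        have h3 : power R one (s + 1) ∈ J := by
          have h4 := ih _ _ h1 0 (by omega)
          refine (Submodule.smul_mem_iff J (mul_ne_zero hc ?_)).1 h4
          rw [Nat.cast_zero, zero_sub, neg_ne_zero]
          exact Nat.cast_ne_zero.2 (by omega)
        clear hi
        induction i with
        | zero => exact h3
        | succ i ih => exact hJR _ ih
      rw [Finset.sum_range_succ'] at h
      refine (Submodule.add_mem_iff_right J (sum_mem fun i hi => J.smul_mem _ ?_)).1 h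
      have := h2 i (Finset.mem_range.1 hi)
      rwa [show s + 1 + i = s + (i + 1) by omega] at this
    have h1 : ∑ i ∈ Finset.range n, c (i + 1) • power R one (s + 1 + i) ∈ J := by
      rw [Finset.sum_range_succ'] at h
      refine (Submodule.add_mem_iff_left J h0).1 ?_
      convert h using 5 <;> omega
    intro i hi
    cases i with
    | zero => exact h0
    | succ i =>
      have := ih _ _ h1 i (by omega)
      rwa [show s + 1 + i = s + (i + 1) by omega] at this

theorem smul_power_mem (hRA : ∀ a b g, A a (R b g) = R b (A a g) + R a (R b g))
    (hone : ∀ a, A a one = R a one) {J : Submodule K T} (hJR : ∀ u ∈ J, R 1 u ∈ J)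
    (hJA : ∀ u ∈ J, A 1 u ∈ J) {c : ℕ →₀ K}
    (h : Finsupp.linearCombination K (power R one) c ∈ J) (k : ℕ) : c k • power R one k ∈ J := by
  by_cases hk : c k = 0
  · rw [hk, zero_smul]; exact zero_mem _
  obtain ⟨n, hn⟩ := Finset.exists_nat_subset_range c.support
  rw [Finsupp.linearCombination_apply, Finsupp.sum_of_support_subset c hn _ (by simp)] at h
  have := smul_power_mem_of_sum_mem hRA hone hJR hJA n c 0 (by simpa using h) k
    (Finset.mem_range.1 (hn (Finsupp.mem_support_iff.2 hk)))
  simpa using this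

end Powers

/-! ### Recognizing the elements of I inside its hull J. -/

section Detection

variable {R A : Fin 2 → T →ₗ[K] T} {one : T} {d : Fin 2 → T →ₗ[K] T} {ε : T →ₗ[K] K}
  {I : Submodule K T}

theorem counit_eq_zero_of_mem_closure (hεR : ∀ a g, ε (R a g) = 0)
    (hI : ∀ i ∈ I, ∃ (α β : K) (v : T), i = α • R 0 one + β • R 1 one + appendSkew R v) {u : T}
    (hu : u ∈ closure R I) : ε u = 0 := by
  have h : closure R I ≤ LinearMap.ker ε := by
    refine closure_le (fun i hi => ?_) fun a u _ => hεR a u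
    obtain ⟨α, β, v, rfl⟩ := hI i hi
    simp [appendSkew_apply, hεR]
  exact h hu

/-- The last-letter analysis of an element `u x` of the closure of `I`. -/
theorem exists_of_append_mem_closureStep (hd : ∀ a b g, d a (R b g) = if a = b then g else 0)
    (hεR : ∀ a g, ε (R a g) = 0) (hε : ε one = 1)
    (hI : ∀ i ∈ I, ∃ (α β : K) (v : T), i = α • R 0 one + β • R 1 one + appendSkew R v)
    {m : ℕ} {u : T} (hu : R 0 u ∈ closureStep R I (m + 1)) :
    ∃ (α : K) (v : T), α • R 0 one + appendSkew R v ∈ I ∧ R 0 v ∈ closureStep R I m ∧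
      u + R 1 v - α • one ∈ closureStep R I m := by
  obtain ⟨i, hi, k, hk, l, hl, h⟩ := mem_closureStep_succ.1 hu
  obtain ⟨α, β, v, rfl⟩ := hI i hi
  -- Last letters give u = α − v y + k and 0 = β + v x + l; the constant term of the latter gives β
  -- = 0.
  have h0 := congrArg (d 0) h
  have h1 := congrArg (d 1) h
  simp only [appendSkew_apply, map_add, map_sub, map_smul, hd, if_true, Fin.isValue, one_ne_zero,
    zero_ne_one, if_false, smul_zero, add_zero, zero_add, zero_sub, sub_zero] at h0 h1
  have h2 := congrArg ε h1
  rw [map_zero, map_add, map_add, hεR, map_smul, hε,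
    counit_eq_zero_of_mem_closure hεR hI (closureStep_le_closure m hl), smul_eq_mul, mul_one,
    add_zero, add_zero] at h2
  rw [← h2, zero_smul, zero_add] at h1
  refine ⟨α, v, ?_, ?_, ?_⟩
  · rwa [← h2, zero_smul, add_zero] at hi
  · rw [eq_neg_of_add_eq_zero_left h1.symm]
    exact neg_mem hl
  · rw [h0]
    convert hk using 1
    abel

/-- The last-letter analysis gives u ≡ α − v y modulo J, with v x one step lower in the filtration.
-/
theorem exists_power_of_append_mem (hd : ∀ a b g, d a (R b g) = if a = b then g else 0)
    (hεR : ∀ a g, ε (R a g) = 0) (hε : ε one = 1)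
    (hI : ∀ i ∈ I, ∃ (α β : K) (v : T), i = α • R 0 one + β • R 1 one + appendSkew R v)
    (m : ℕ) : ∀ u, R 0 u ∈ closureStep R I m →
      ∃ c : ℕ →₀ K, u - Finsupp.linearCombination K (power R one) c ∈ closure R I := by
  induction m with
  | zero =>
    intro u hu
    have h : R 0 u = 0 := hu
    have h0 := congrArg (d 0) h
    rw [hd, if_pos rfl, map_zero] at h0
    exact ⟨0, by simp [h0]⟩
  | succ m ih =>
    intro u hu
    obtain ⟨α, v, -, h1, h2⟩ := exists_of_append_mem_closureStep hd hεR hε hI hu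
    obtain ⟨c, hc⟩ := ih v h1
    refine ⟨Finsupp.single 0 α - c.mapDomain Nat.succ, ?_⟩
    rw [map_sub, Finsupp.linearCombination_single, Finsupp.linearCombination_mapDomain]
    rw [linearCombination_power_succ]
    convert sub_mem (closureStep_le_closure m h2) (map_mem_closure 1 hc) using 1
    rw [map_sub, power]
    abel

variable [CharZero K]

/-- Write yˢ ≡ α − v y modulo J with αx + v w ∈ I and v ≡ p(y), put e = p(y) y − α, and let Q send
yᵏ to (k + 1) yᵏ w. The terms of e + yˢ lie in J, so Q(e + yˢ) ∈ I. Also Q(e) ∈ I, being modulo I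
the commutator of y with αx + v w, because y ш yᵏ + yᵏ y = (k + 2) yᵏ⁺¹. The difference is (s + 1)
yˢ w. -/
theorem appendSkew_power_mem (hRA : ∀ a b g, A a (R b g) = R b (A a g) + R a (R b g))
    (hA : ∀ g, A 0 (A 1 g) = A 1 (A 0 g)) (hone : ∀ a, A a one = R a one)
    (hd : ∀ a b g, d a (R b g) = if a = b then g else 0)
    (hεR : ∀ a g, ε (R a g) = 0) (hε : ε one = 1)
    (hI : ∀ i ∈ I, ∃ (α β : K) (v : T), i = α • R 0 one + β • R 1 one + appendSkew R v)
    (hD : ∀ a, ∀ f ∈ I, A a f - (2 : ℕ) • R a f ∈ I)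
    (hJA : ∀ u ∈ closure R I, A 1 u ∈ closure R I) {s : ℕ}
    (hs : R 0 (power R one s) ∈ closure R I) : appendSkew R (power R one s) ∈ I := by
  have hW : ∀ u ∈ closure R I, appendSkew R u ∈ I :=
    fun u => appendSkew_mem_of_mem_closure hRA hA hD
  obtain ⟨m, hm⟩ := mem_closure.1 hs
  obtain ⟨α, v, h1, h2, h3⟩ := exists_of_append_mem_closureStep hd hεR hε hI
    (closureStep_mono m.le_succ hm)
  obtain ⟨c, hc⟩ := exists_power_of_append_mem hd hεR hε hI m v h2
  set e : ℕ →₀ K := c.mapDomain Nat.succ - Finsupp.single 0 α with he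
  let Q := Finsupp.linearCombination K fun k : ℕ => ((k : K) + 1) • appendSkew R (power R one k)
  have hP : Finsupp.linearCombination K (power R one) (e + Finsupp.single s 1) ∈ closure R I := by
    rw [map_add, he, map_sub, Finsupp.linearCombination_single, Finsupp.linearCombination_single,
      Finsupp.linearCombination_mapDomain]
    rw [linearCombination_power_succ]
    convert sub_mem (closureStep_le_closure m h3) (map_mem_closure 1 hc) using 1
    rw [map_sub, one_smul]
    change _ - α • one + _ = _
    abel
  have hQ : Q (e + Finsupp.single s 1) ∈ I := by
    refine Submodule.sum_mem _ fun k _ => ?_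
    have h := hW _ (smul_power_mem hRA hone (fun u => map_mem_closure 1) hJA hP k)
    rw [map_smul] at h
    simp only [LinearMap.coe_smulRight, LinearMap.id_coe, id_eq]
    rw [smul_comm]
    exact I.smul_mem _ h
  have hQ' : Q e ∈ I := by
    have h4 := hD 1 _ h1
    have h5 : A 1 (α • R 0 one + appendSkew R v) -
        (2 : ℕ) • R 1 (α • R 0 one + appendSkew R v) =
          appendSkew R (A 1 v + R 1 v) - α • appendSkew R one := by
      rw [map_add, map_add, shuffle_appendSkew hRA, map_smul, map_smul, hRA, hone,
        appendSkew_apply one, smul_sub, smul_add, two_nsmul, two_nsmul]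
      abel
    rw [h5] at h4
    have h6 : appendSkew R (A 1 (v - Finsupp.linearCombination K (power R one) c) +
        R 1 (v - Finsupp.linearCombination K (power R one) c)) ∈ I :=
      hW _ (add_mem (hJA _ hc) (map_mem_closure 1 hc))
    have h7 : Q (c.mapDomain Nat.succ) =
        appendSkew R (A 1 (Finsupp.linearCombination K (power R one) c) +
          R 1 (Finsupp.linearCombination K (power R one) c)) := by
      rw [Finsupp.linearCombination_mapDomain]
      change _ = (appendSkew R ∘ₗ (A 1 + R 1)) (Finsupp.linearCombination K (power R one) c)
      rw [Finsupp.apply_linearCombination]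
      congr 2
      funext k
      simp only [LinearMap.comp_apply, Function.comp_apply, LinearMap.add_apply,
        shuffle_power hRA hone]
      rw [map_add, map_smul]
      change _ = _ + appendSkew R (power R one (k + 1))
      rw [show ((Nat.succ k : ℕ) : K) + 1 = (k : K) + 1 + 1 by push_cast; rfl,
        add_smul _ (1 : K), one_smul]
    rw [he, map_sub, h7, Finsupp.linearCombination_single]
    convert sub_mem h4 h6 using 1
    simp only [map_sub, map_add, power, Nat.cast_zero, zero_add, one_smul]
    abel
  have h8 := sub_mem hQ hQ'
  rw [map_add, add_sub_cancel_left, Finsupp.linearCombination_single, one_smul] at h8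
  exact (Submodule.smul_mem_iff I (Nat.cast_add_one_ne_zero s)).1 h8

/-- From u x ∈ J, u ≡ p(y); from u y ∈ J, the terms of p(y) y lie in J. If s is the lowest exponent
of p, all higher powers lie in J, so u ≡ c yˢ and yˢ x ∈ J. -/
theorem appendSkew_mem_of_append_mem
    (hRA : ∀ a b g, A a (R b g) = R b (A a g) + R a (R b g))
    (hA : ∀ g, A 0 (A 1 g) = A 1 (A 0 g)) (hone : ∀ a, A a one = R a one)
    (hd : ∀ a b g, d a (R b g) = if a = b then g else 0)
    (hεR : ∀ a g, ε (R a g) = 0) (hε : ε one = 1)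
    (hI : ∀ i ∈ I, ∃ (α β : K) (v : T), i = α • R 0 one + β • R 1 one + appendSkew R v)
    (hD : ∀ a, ∀ f ∈ I, A a f - (2 : ℕ) • R a f ∈ I)
    (hJA : ∀ u ∈ closure R I, A 1 u ∈ closure R I) {u : T}
    (h0 : R 0 u ∈ closure R I) (h1 : R 1 u ∈ closure R I) : appendSkew R u ∈ I := by
  have hW : ∀ u ∈ closure R I, appendSkew R u ∈ I :=
    fun u => appendSkew_mem_of_mem_closure hRA hA hD
  obtain ⟨m, hm⟩ := mem_closure.1 h0
  obtain ⟨c, hc⟩ := exists_power_of_append_mem hd hεR hε hI m u hm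
  have hc1 : ∀ k, c k • power R one (k + 1) ∈ closure R I := by
    intro k
    have h2 : Finsupp.linearCombination K (power R one) (c.mapDomain Nat.succ) ∈ closure R I := by
      rw [Finsupp.linearCombination_mapDomain]
      rw [linearCombination_power_succ]
      convert sub_mem h1 (map_mem_closure 1 hc) using 1
      rw [map_sub]
      abel
    have h3 := smul_power_mem hRA hone (fun u => map_mem_closure 1) hJA h2 (k + 1)
    rwa [show k + 1 = Nat.succ k from rfl, Finsupp.mapDomain_apply Nat.succ_injective] at h3
  rcases eq_or_ne c 0 with rfl | hc0
  · rw [map_zero, sub_zero] at hc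
    exact hW u hc
  have hex : ∃ k, c k ≠ 0 := by
    by_contra! h
    exact hc0 (Finsupp.ext h)
  classical
  let s := Nat.find hex
  have hs : c s ≠ 0 := Nat.find_spec hex
  have hpow : ∀ j, power R one (s + 1 + j) ∈ closure R I := by
    intro j
    induction j with
    | zero => exact (Submodule.smul_mem_iff _ hs).1 (hc1 s)
    | succ j ih => exact map_mem_closure 1 ih
  have hsum : Finsupp.linearCombination K (power R one) c - c s • power R one s ∈
      closure R I := by
    rw [← Finsupp.linearCombination_single, ← map_sub]
    refine Submodule.sum_mem _ fun k _ => ?_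
    simp only [LinearMap.coe_smulRight, LinearMap.id_coe, id_eq, Finsupp.sub_apply]
    rcases lt_trichotomy k s with hk | rfl | hk
    · have h5 : c k = 0 := by
        by_contra h
        exact Nat.find_min hex hk h
      rw [h5, Finsupp.single_eq_of_ne hk.ne, sub_zero, zero_smul]
      exact zero_mem _
    · simp
    · refine Submodule.smul_mem _ _ ?_
      obtain ⟨j, rfl⟩ := Nat.exists_eq_add_of_le (Nat.succ_le_of_lt hk)
      exact hpow j
  have hu : u - c s • power R one s ∈ closure R I := by
    convert add_mem hc hsum using 1
    abel
  have hxs : R 0 (power R one s) ∈ closure R I := by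
    refine (Submodule.smul_mem_iff _ hs).1 ?_
    convert sub_mem h0 (map_mem_closure 0 hu) using 1
    rw [map_sub, map_smul]
    abel
  have h6 := add_mem (hW _ hu) (I.smul_mem (c s)
    (appendSkew_power_mem hRA hA hone hd hεR hε hI hD hJA hxs))
  rwa [map_sub, map_smul, sub_add_cancel] at h6

/-- An element of the closure of `I` of the form `αx + βy + u(xy - yx)` lies in `I`. -/
theorem mem_of_mem_closure
    (hRA : ∀ a b g, A a (R b g) = R b (A a g) + R a (R b g))
    (hA : ∀ g, A 0 (A 1 g) = A 1 (A 0 g)) (hone : ∀ a, A a one = R a one)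
    (hd : ∀ a b g, d a (R b g) = if a = b then g else 0)
    (hεR : ∀ a g, ε (R a g) = 0) (hε : ε one = 1)
    (hI : ∀ i ∈ I, ∃ (α β : K) (v : T), i = α • R 0 one + β • R 1 one + appendSkew R v)
    (hD : ∀ a, ∀ f ∈ I, A a f - (2 : ℕ) • R a f ∈ I)
    (hJA : ∀ u ∈ closure R I, A 1 u ∈ closure R I) {α β : K} {u : T}
    (hu : α • R 0 one + β • R 1 one + appendSkew R u ∈ closure R I) :
    α • R 0 one + β • R 1 one + appendSkew R u ∈ I := by
  obtain ⟨m, hm⟩ := mem_closure.1 hu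
  obtain ⟨i, hi, k, hk, l, hl, h⟩ := mem_closureStep_succ.1 (closureStep_mono m.le_succ hm)
  have hk' := closureStep_le_closure m hk
  have hl' := closureStep_le_closure m hl
  obtain ⟨α', β', v, rfl⟩ := hI i hi
  have h0 := congrArg (d 0) h
  have h1 := congrArg (d 1) h
  simp only [appendSkew_apply, map_add, map_sub, map_smul, hd, if_true, Fin.isValue, one_ne_zero,
    zero_ne_one, if_false, smul_zero, add_zero, zero_add, zero_sub, sub_zero] at h0 h1
  -- Constant terms identify α and β with those of i; what remains is (u − v) x = l and (u − v) y =
  -- −k, both in J.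
  have e0 := congrArg ε h0
  have e1 := congrArg ε h1
  simp only [map_add, map_neg, map_smul, hεR, hε, smul_eq_mul, mul_one, neg_zero, add_zero,
    counit_eq_zero_of_mem_closure hεR hI hk', counit_eq_zero_of_mem_closure hεR hI hl'] at e0 e1
  subst e0 e1
  have h2 : appendSkew R (u - v) ∈ I := by
    refine appendSkew_mem_of_append_mem hRA hA hone hd hεR hε hI hD hJA ?_ ?_
    · convert hl' using 1
      rw [map_sub, sub_eq_iff_eq_add]
      have := add_left_cancel (h1.trans (add_assoc _ _ _))
      rw [this, add_comm]
    · convert neg_mem hk' using 1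
      rw [map_sub, sub_eq_iff_eq_add]
      have := add_left_cancel (h0.trans (add_assoc _ _ _))
      rw [← neg_inj, this]
      abel
  convert add_mem hi h2 using 1
  rw [map_sub]
  abel

end Detection

end LetterOperators

/-! ### The ideal of Zin(x, y) generated by an ideal of ST(x, y). -/

namespace Zin

open LetterOperators

/-- The underlying subspace of the free special Tortkara algebra. -/
noncomputable def specialElements (K X : Type*) [Field K] : Submodule K (Zin K X) where
  carrier := {z | Minus.of z ∈ FreeSpecialTortkara K X}
  add_mem' := fun ha hb => (FreeSpecialTortkara K X).toSubmodule.add_mem ha hb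
  zero_mem' := zero_mem (FreeSpecialTortkara K X)
  smul_mem' := fun c _ ha => (FreeSpecialTortkara K X).toSubmodule.smul_mem c ha

theorem mem_specialElements {K X : Type*} [Field K] {u : Zin K X} :
    u ∈ specialElements K X ↔ Minus.of u ∈ FreeSpecialTortkara K X := Iff.rfl

theorem gen_mem_specialElements (K : Type*) {X : Type*} [Field K] (x : X) :
    gen K x ∈ specialElements K X :=
  mem_specialElements.2 (NonUnitalAlgebra.subset_adjoin K ⟨x, rfl⟩)

theorem commutator_mem_specialElements {K X : Type*} [Field K] {u v : Zin K X}
    (hu : u ∈ specialElements K X) (hv : v ∈ specialElements K X) :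
    u * v - v * u ∈ specialElements K X :=
  mem_specialElements.2
    (mul_mem (mem_specialElements.1 hu) (mem_specialElements.1 hv))

theorem append_one {K X : Type*} [Field K] (a : X) :
    append a ((1, 0) : K × Zin K X) = (0, gen K a) := by
  simp [append_apply]

variable {K : Type*} [Field K]

section Stable

variable {I : Submodule K (Zin K (Fin 2))}

theorem shuffleLetter_sub_mem (hI : ∀ a, ∀ f ∈ I, gen K a * f - f * gen K a ∈ I) (a : Fin 2) :
    ∀ f ∈ I.map (LinearMap.inr K K (Zin K (Fin 2))),
      shuffleLetter a f - (2 : ℕ) • append a f ∈ I.map (LinearMap.inr K K (Zin K (Fin 2))) := by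
  rintro _ ⟨f, hf, rfl⟩
  exact ⟨_, hI a f hf, inr_comm_gen f a⟩

theorem mem_of_inr_mem {z : Zin K (Fin 2)}
    (h : ((0, z) : K × Zin K (Fin 2)) ∈ I.map (LinearMap.inr K K (Zin K (Fin 2)))) : z ∈ I := by
  obtain ⟨y, hy, h⟩ := h
  obtain rfl : y = z := congrArg Prod.snd h
  exact hy

end Stable

variable [CharZero K]

/-- `ST({x, y})` contains all elements `u(xy - yx)`. -/
theorem appendSkew_mem_specialElements (g : K × Zin K (Fin 2)) :
    ∃ z ∈ specialElements K (Fin 2), appendSkew append g = (0, z) := by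
  let S := (specialElements K (Fin 2)).map (LinearMap.inr K K (Zin K (Fin 2)))
  suffices h : g ∈ S.comap (appendSkew append) by
    obtain ⟨z, hz, h⟩ := h
    exact ⟨z, hz, h.symm⟩
  have hS : ∀ a, ∀ f ∈ S, shuffleLetter a f - (2 : ℕ) • append a f ∈ S :=
    shuffleLetter_sub_mem fun a f hf =>
      commutator_mem_specialElements (gen_mem_specialElements K a) hf
  refine append_mem_wordSpan_induction (fun n => Submodule.span_le.2 ?_) g
  rintro _ ⟨t, -, rfl⟩
  cases t with
  | nil =>
    refine ⟨_, commutator_mem_specialElements (gen_mem_specialElements K 0)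
      (gen_mem_specialElements K 1), ?_⟩
    rw [word_nil, appendSkew_apply, append_one, append_one, ← inr_mul_gen, ← inr_mul_gen,
      Prod.mk_sub_mk, sub_zero]
    rfl
  | cons a t =>
    rw [word_cons]
    refine appendSkew_word_mem shuffleLetter_append (shuffleLetter_comm 0 1) hS _ _ ?_ t rfl
    exact ⟨_, gen_mem_specialElements K a, (append_one a).symm⟩

section Ideal

variable {I : Submodule K (Zin K (Fin 2))}

/-- The right-stable hull of a subspace of `Zin({x, y})`. -/
noncomputable def rightHull (I : Submodule K (Zin K (Fin 2))) : Submodule K (Zin K (Fin 2)) :=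
  (LetterOperators.closure append (I.map (LinearMap.inr K K (Zin K (Fin 2))))).comap
    (LinearMap.inr K K (Zin K (Fin 2)))

omit [CharZero K] in
theorem le_rightHull : I ≤ rightHull I := by
  intro f hf
  rw [rightHull, Submodule.mem_comap]
  exact le_closure (Submodule.mem_map_of_mem hf)

omit [CharZero K] in
theorem mul_gen_mem_rightHull (a : Fin 2) {u : Zin K (Fin 2)} (hu : u ∈ rightHull I) :
    u * gen K a ∈ rightHull I := by
  change ((0, u * gen K a) : K × Zin K (Fin 2)) ∈ LetterOperators.closure append _
  rw [inr_mul_gen]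
  exact map_mem_closure a hu

omit [CharZero K] in
theorem closure_le_map {N : Submodule K (Zin K (Fin 2))} (hI : I ≤ N)
    (hN : ∀ a, ∀ u ∈ N, u * gen K a ∈ N) :
    LetterOperators.closure append (I.map (LinearMap.inr K K (Zin K (Fin 2)))) ≤
      N.map (LinearMap.inr K K (Zin K (Fin 2))) := by
  refine closure_le (Submodule.map_mono hI) ?_
  rintro a _ ⟨u, hu, rfl⟩
  exact ⟨_, hN a u hu, inr_mul_gen u a⟩

omit [CharZero K] in
theorem rightHull_le {N : Submodule K (Zin K (Fin 2))} (hI : I ≤ N)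
    (hN : ∀ a, ∀ u ∈ N, u * gen K a ∈ N) : rightHull I ≤ N := fun _ hu =>
  mem_of_inr_mem (closure_le_map hI hN hu)

/-- Induction on the degree of g. If g = v w, then g ∈ ST and g ∘ f = [g, f] + f ∘ g. For shuffles,
(a ш g) ∘ f = g ∘ (a ∘ f) = g ∘ [a, f] + (g ∘ f + f ∘ g) a. -/
theorem mul_mem_rightHull_of_mem
    (hI : ∀ g ∈ specialElements K (Fin 2), ∀ f ∈ I, g * f - f * g ∈ I) (g : Zin K (Fin 2)) :
    ∀ f ∈ I, g * f ∈ rightHull I := by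
  let N : Submodule K (K × Zin K (Fin 2)) :=
    { carrier := {g | ∀ f ∈ I, g.1 • f + g.2 * f ∈ rightHull I}
      add_mem' := by
        intro g h hg hh f hf
        convert add_mem (hg f hf) (hh f hf) using 1
        rw [Prod.fst_add, Prod.snd_add, add_smul, add_mul]
        abel
      zero_mem' := by
        intro f _
        simp
      smul_mem' := by
        intro c g hg f hf
        convert (rightHull I).smul_mem c (hg f hf) using 1
        rw [Prod.smul_fst, Prod.smul_snd, smul_add, smul_mul_assoc, smul_assoc] }
  -- The conventions 1 ∘ f = f in N and f ∘ 1 = 0 in M keep f ∘ (g a) = (f ∘ g + g ∘ f) a valid for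
  -- g = 1.
  let M : Submodule K (K × Zin K (Fin 2)) :=
    { carrier := {g | ∀ f ∈ I, f * g.2 ∈ rightHull I}
      add_mem' := by
        intro g h hg hh f hf
        rw [Prod.snd_add, mul_add]
        exact add_mem (hg f hf) (hh f hf)
      zero_mem' := by
        intro f _
        simp
      smul_mem' := by
        intro c g hg f hf
        rw [Prod.smul_snd, mul_smul_comm]
        exact (rightHull I).smul_mem c (hg f hf) }
  have hz := isZinbiel K (Fin 2)
  have hM : ∀ a, ∀ g ∈ N, g ∈ M → append a g ∈ M := by
    intro a g hg hg' f hf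
    rw [append_apply, mul_add, hz, mul_smul_comm, ← smul_mul_assoc, ← add_mul]
    refine mul_gen_mem_rightHull a ?_
    convert add_mem (hg f hf) (hg' f hf) using 1
    abel
  have hwM : ∀ n, wordSpan append ((1, 0) : K × Zin K (Fin 2)) n ≤ N →
      wordSpan append ((1, 0) : K × Zin K (Fin 2)) n ≤ M →
      wordSpan append ((1, 0) : K × Zin K (Fin 2)) (n + 1) ≤ M := by
    intro n h1 h2
    refine Submodule.span_le.2 ?_
    rintro _ ⟨t, ht, rfl⟩
    induction t using List.reverseRecOn with
    | nil => simp at ht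
    | append_singleton t a _ =>
      obtain rfl : t.length = n := by simpa using ht
      rw [word_concat]
      exact hM a _ (h1 (word_mem_wordSpan _ t)) (h2 (word_mem_wordSpan _ t))
  have hgen : ∀ a, ∀ f ∈ I, gen K a * f - f * gen K a ∈ I := fun a f hf =>
    hI _ (gen_mem_specialElements K a) f hf
  have key : ∀ n, wordSpan append ((1, 0) : K × Zin K (Fin 2)) n ≤ N ∧
      wordSpan append ((1, 0) : K × Zin K (Fin 2)) n ≤ M := by
    intro n
    induction n using Nat.strong_induction_on with
    | _ n ih =>
      rcases n with _ | _ | k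
      · constructor <;> refine Submodule.span_le.2 ?_ <;> rintro _ ⟨t, ht, rfl⟩ <;>
          rw [List.length_eq_zero_iff] at ht <;> subst ht <;> intro f hf
        · simpa [word_nil] using le_rightHull hf
        · simp [word_nil]
      · refine ⟨Submodule.span_le.2 ?_, hwM 0 (ih 0 (by omega)).1 (ih 0 (by omega)).2⟩
        rintro _ ⟨t, ht, rfl⟩
        obtain ⟨a, rfl⟩ := List.length_eq_one_iff.1 ht
        intro f hf
        change (append a ((1, 0) : K × Zin K (Fin 2))).1 • f +
          (append a ((1, 0) : K × Zin K (Fin 2))).2 * f ∈ _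
        rw [append_one, zero_smul, zero_add, ← sub_add_cancel (gen K a * f) (f * gen K a)]
        exact add_mem (le_rightHull (hgen a f hf)) (mul_gen_mem_rightHull a (le_rightHull hf))
      · obtain ⟨h1, h2⟩ := ih (k + 1) (by omega)
        refine ⟨wordSpan_le (A := shuffleLetter) shuffleLetter_append shuffleLetter_one ?_ ?_,
          hwM _ h1 h2⟩
        · intro g hg f hf
          have h3 : appendSkew append g ∈ M := sub_mem
            (hM 1 _ (h1 (map_mem_wordSpan 0 hg)) (h2 (map_mem_wordSpan 0 hg)))
            (hM 0 _ (h1 (map_mem_wordSpan 1 hg)) (h2 (map_mem_wordSpan 1 hg)))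
          have h4 := h3 f hf
          obtain ⟨z, hz, h5⟩ := appendSkew_mem_specialElements g
          rw [h5] at h4 ⊢
          rw [zero_smul, zero_add, ← sub_add_cancel (z * f) (f * z)]
          exact add_mem (le_rightHull (hI z hz f hf)) h4
        · intro a g hg f hf
          have h3 := h1 hg _ (hgen a f hf)
          have h4 := mul_gen_mem_rightHull a (add_mem (h1 hg f hf) (h2 hg f hf))
          rw [shuffleLetter_apply, zero_smul, zero_add]
          convert add_mem h3 h4 using 1
          have h5 : g.2 * (f * gen K a) = (g.2 * f + f * g.2) * gen K a := hz _ _ _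
          have h6 : (gen K a * g.2 + g.2 * gen K a) * f = g.2 * (gen K a * f) := by
            rw [hz, add_comm]
          rw [add_mul, h6, mul_sub, h5, smul_sub]
          simp only [add_mul, smul_mul_assoc]
          abel
  intro f hf
  have h := append_mem_wordSpan_induction (fun n => (key n).1) (0, g) f hf
  simpa using h

/-- Last letters move out of products by the Zinbiel identity, so only the products z ∘ f with f ∈ I
need the previous lemma. -/
theorem mul_mem_rightHull
    (hI : ∀ g ∈ specialElements K (Fin 2), ∀ f ∈ I, g * f - f * g ∈ I) {u : Zin K (Fin 2)}
    (hu : u ∈ rightHull I) : ∀ z, z * u ∈ rightHull I ∧ u * z ∈ rightHull I := by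
  have hz := isZinbiel K (Fin 2)
  let N : Submodule K (Zin K (Fin 2)) :=
    { carrier := {u | u ∈ rightHull I ∧ ∀ z, z * u ∈ rightHull I}
      add_mem' := fun ha hb => ⟨add_mem ha.1 hb.1, fun z => by
        rw [mul_add]; exact add_mem (ha.2 z) (hb.2 z)⟩
      zero_mem' := ⟨zero_mem _, fun z => by rw [mul_zero]; exact zero_mem _⟩
      smul_mem' := fun c u hu => ⟨Submodule.smul_mem _ c hu.1, fun z => by
        rw [mul_smul_comm]; exact Submodule.smul_mem _ c (hu.2 z)⟩ }
  have hN : ∀ u ∈ N, ∀ z, u * z ∈ rightHull I := by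
    intro u hu z
    refine mem_of_mul_gen_mem (U := (rightHull I).comap (LinearMap.mulLeft K u)) ?_ ?_ z
    · exact fun x => mul_gen_mem_rightHull x hu.1
    · intro v hv x
      change u * (v * gen K x) ∈ rightHull I
      rw [hz]
      exact mul_gen_mem_rightHull x (add_mem hv (hu.2 v))
  have h : rightHull I ≤ N := by
    refine rightHull_le (fun f hf => ⟨le_rightHull hf, fun z =>
      mul_mem_rightHull_of_mem hI z f hf⟩) fun a u hu => ⟨mul_gen_mem_rightHull a hu.1, fun z => ?_⟩
    rw [hz]
    exact mul_gen_mem_rightHull a (add_mem (hu.2 z) (hN u hu z))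
  exact fun z => ⟨(h hu).2 z, hN u (h hu) z⟩

/-- The Zinbiel ideal generated by an ideal `I` of `ST({x, y})` meets `ST({x, y})` in `I`. -/
theorem mem_of_mem_rightHull
    (hI : ∀ g ∈ specialElements K (Fin 2), ∀ f ∈ I, g * f - f * g ∈ I)
    (hIS : I ≤ specialElements K (Fin 2)) {u : Zin K (Fin 2)} (hu : u ∈ rightHull I)
    (hu' : u ∈ specialElements K (Fin 2)) : u ∈ I := by
  have hform : ∀ i ∈ I.map (LinearMap.inr K K (Zin K (Fin 2))), ∃ (α β : K)
      (v : K × Zin K (Fin 2)), i = α • append 0 (1, 0) + β • append 1 (1, 0) +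
        appendSkew append v := by
    rintro _ ⟨f, hf, rfl⟩
    exact exists_of_mem_skewElements (freeSpecialTortkara_subset (mem_specialElements.1 (hIS hf)))
  have hclosure : ∀ v ∈ LetterOperators.closure append (I.map (LinearMap.inr K K (Zin K (Fin 2)))),
      shuffleLetter 1 v ∈
        LetterOperators.closure append (I.map (LinearMap.inr K K (Zin K (Fin 2)))) := by
    intro v hv
    obtain ⟨z, hz, rfl⟩ := closure_le_map le_rightHull (fun a _ => mul_gen_mem_rightHull a) hv
    obtain ⟨h1, h2⟩ := mul_mem_rightHull hI hz (gen K 1)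
    have h3 := add_mem h1 h2
    rw [LinearMap.inr_apply, shuffleLetter_apply, zero_smul, zero_add]
    exact h3
  obtain ⟨α, β, v, h⟩ := exists_of_mem_skewElements (u := u)
    (freeSpecialTortkara_subset (mem_specialElements.1 hu'))
  have hu2 : ((0, u) : K × Zin K (Fin 2)) ∈ LetterOperators.closure append _ := hu
  rw [h] at hu2
  refine mem_of_inr_mem ?_
  rw [h]
  exact mem_of_mem_closure (A := shuffleLetter) (d := derivOne) (ε := LinearMap.fst K K _)
    shuffleLetter_append (shuffleLetter_comm 0 1) shuffleLetter_one derivOne_append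
    (fun _ _ => rfl) rfl hform
    (shuffleLetter_sub_mem fun a f hf => hI _ (gen_mem_specialElements K a) f hf) hclosure hu2

end Ideal

end Zin

/-- Every homomorphic image of `ST({x, y})` is special. -/
theorem isSpecial_of_surjective (K : Type u) [Field K] [CharZero K] (B : Type v)
    [NonUnitalNonAssocRing B] [Module K B] (φ : FreeSpecialTortkara K (Fin 2) →ₙₐ[K] B)
    (hφ : Function.Surjective φ) : IsSpecial.{u} K B := by
  let ι : FreeSpecialTortkara K (Fin 2) →ₙₐ[K] Minus (Zin K (Fin 2)) :=
    NonUnitalSubalgebraClass.subtype _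
  let I : Submodule K (Zin K (Fin 2)) :=
    (LinearMap.ker (φ : FreeSpecialTortkara K (Fin 2) →ₗ[K] B)).map
      (ι : FreeSpecialTortkara K (Fin 2) →ₗ[K] Minus (Zin K (Fin 2)))
  have hmemI : ∀ s : FreeSpecialTortkara K (Fin 2), Minus.val (s : Minus (Zin K (Fin 2))) ∈ I ↔
      φ s = 0 := by
    intro s
    constructor
    · rintro ⟨t, ht, h⟩
      obtain rfl : t = s := Subtype.ext h
      exact ht
    · exact fun h => ⟨s, h, rfl⟩
  have hIS : I ≤ Zin.specialElements K (Fin 2) := by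
    rintro _ ⟨t, -, rfl⟩
    exact Zin.mem_specialElements.2 t.2
  have hI : ∀ g ∈ Zin.specialElements K (Fin 2), ∀ f ∈ I, g * f - f * g ∈ I := by
    intro g hg f hf
    let f' : FreeSpecialTortkara K (Fin 2) := ⟨_, Zin.mem_specialElements.1 (hIS hf)⟩
    let g' : FreeSpecialTortkara K (Fin 2) := ⟨_, Zin.mem_specialElements.1 hg⟩
    have h : φ f' = 0 := (hmemI f').1 hf
    refine (hmemI (g' * f')).2 ?_
    rw [map_mul, h, mul_zero]
  let J : AlgIdeal K (Zin K (Fin 2)) :=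
    { Zin.rightHull I with
      mul_mem_left := fun a _ hb => (Zin.mul_mem_rightHull hI hb a).1
      mul_mem_right := fun a _ hb => (Zin.mul_mem_rightHull hI hb a).2 }
  have hJ : ∀ s t : FreeSpecialTortkara K (Fin 2),
      J.proj (Minus.val (s : Minus (Zin K (Fin 2)))) = J.proj (Minus.val (t : Minus (Zin K (Fin 2))))
        ↔ φ s = φ t := by
    intro s t
    rw [J.proj_eq_proj, ← sub_eq_zero (a := φ s), ← map_sub, ← hmemI]
    exact ⟨fun h => Zin.mem_of_mem_rightHull hI hIS h
      (Zin.mem_specialElements.2 (s - t).2), fun h => Zin.le_rightHull h⟩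
  have hJZ : IsZinbiel J.Quotient := by
    intro a b c
    obtain ⟨a, rfl⟩ := J.proj_surjective a
    obtain ⟨b, rfl⟩ := J.proj_surjective b
    obtain ⟨c, rfl⟩ := J.proj_surjective c
    simp only [← J.proj_mul, ← map_add]
    rw [Zin.isZinbiel K (Fin 2) a b c]
  let σ := Function.surjInv hφ
  have hσ : ∀ b, φ (σ b) = b := Function.surjInv_eq hφ
  -- By `hJ` the value does not depend on the chosen preimage, and the map is injective.
  let f : B → Minus J.Quotient := fun b =>
    Minus.of (J.proj (Minus.val (σ b : Minus (Zin K (Fin 2)))))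
  have hf : ∀ s : FreeSpecialTortkara K (Fin 2),
      f (φ s) = Minus.of (J.proj (Minus.val (s : Minus (Zin K (Fin 2))))) :=
    fun s => (hJ _ _).2 (hσ _)
  let F : B →ₙₐ[K] Minus J.Quotient :=
    { toFun := f
      map_smul' := by
        intro c b
        obtain ⟨s, rfl⟩ := hφ b
        change f (c • φ s) = c • f (φ s)
        rw [← map_smul, hf, hf]
        exact map_smul J.proj c _
      map_zero' := by
        rw [← map_zero φ, hf]
        exact map_zero J.proj
      map_add' := by
        intro a b
        obtain ⟨s, rfl⟩ := hφ a
        obtain ⟨t, rfl⟩ := hφ b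
        rw [← map_add, hf, hf, hf]
        exact map_add J.proj _ _
      map_mul' := by
        intro a b
        obtain ⟨s, rfl⟩ := hφ a
        obtain ⟨t, rfl⟩ := hφ b
        rw [← map_mul, hf, hf, hf]
        exact map_sub J.proj _ _ }
  refine ⟨J.Quotient, inferInstance, inferInstance, inferInstance, inferInstance, hJZ, F, ?_⟩
  intro a b hab
  have := (hJ (σ a) (σ b)).1 hab
  rwa [hσ, hσ] at this

theorem mainTheorem4 (K : Type u) [Field K] [CharZero K] :
    (∀ (B : Type v) [NonUnitalNonAssocRing B] [Module K B] [IsScalarTower K B B]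
        [SMulCommClass K B B] (φ : FreeSpecialTortkara K (Fin 2) →ₙₐ[K] B),
        Function.Surjective φ → IsSpecial.{u} K B) ∧
      (IsTortkara (exceptionalIdeal K).Quotient ∧
        ¬ IsSpecial.{w} K (exceptionalIdeal K).Quotient) :=
  ⟨fun B _ _ _ _ φ hφ => isSpecial_of_surjective K B φ hφ, isTortkara_exceptional K,
    not_isSpecial_exceptional K⟩
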